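/- Let $\lambda$ be the standard product probability measure on the Cantor space $2^{\mathbb N}$, and for $m\in\mathbb N=\{0,1,2,\dots\}$ and $i\in\{0,1\}$ put $V_m^i=\{x\in 2^{\mathbb N}: x(m)=i\}$. For $n\in\mathbb N$ let $\mathcal A_n$ be the finite Boolean algebra of clopen sets generated by $\{V_m^i: 0\le m\le n,\ i=0,1\}$, and for a Borel set $A$ let $\varphi_n(A)=|\lambda(A\cap V_n^0)-\lambda(A\cap V_n^1)|$. A Boolean subalgebra $\mathcal B$ of $Bor(2^{\mathbb N})$ containing $Clopen(2^{\mathbb N})$ has property (T) if for all $A_1,\dots,A_p\in\mathcal B$ and $\varepsilon>0$ there is an integer $n>0$ such that for every atom $U$ of $\mathcal A_n$ and every $1\le i\le p$: (T.1) $\lambda(A_i\cap U)\le\varepsilon\lambda(U)/n$ or $\lambda(U\setminus A_i)\le\varepsilon\lambda(U)/n$; and (T.2) $\varphi_m(A_i\cap U)\le\varepsilon\lambda(U)/m$ for every $m>n$. A measure on a Boolean algebra is a bounded finitely additive real-valued function $\nu$; $|\nu|$ denotes its variation, and $\|\nu\|=|\nu|(1)$ is its total variation. $\mathsf{MA}(\sigma\text{-centered})$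 is the statement that for every nonempty $\sigma$-centered poset $\mathbb P$ (i.e. $\mathbb P$ is a countable union of sets each of whose nonempty finite subsets has a lower bound in $\mathbb P$) and every family of fewer than $\mathfrak c$ dense subsets of $\mathbb P$ there is a filter in $\mathbb P$ meeting every member of the family. **Lemma 3.6.** Let $\mathcal C\subseteq\mathcal B$ be Boolean subalgebras of $Bor(2^{\mathbb N})$ such that $\mathcal C$ is countable and contains $Clopen(2^{\mathbb N})$, and $\mathcal B$ has property (T). Let $(\nu_n)_{n\in\mathbb N}$ be a sequence of measures on $\mathcal C$ and $(H_n)_{n\in\mathbb N}$ a sequence of pairwise disjoint elements of $\mathcal C$ such that $\|\nu_n\|=1$ and $|\nu_n|(H_n)\ge 0.95$ for every $n$. Let $\theta$ be a non-negative measure on $\mathcal C$ with $\lim_{n\to\infty}|\nu_n|(A)=\theta(A)$ for every $A\in\mathcal C$. Assume $\mathsf{MA}(\sigma\text{-centered})$ and $|\mathcal B|<\mathfrak c$. Then there are a Borel set $B\subseteq 2^{\mathbb N}$ and a strictly increasing sequence $(n_k)_{k\in\mathbb N}$ of natural numbers such that the Boolean algebra generated by $\mathcal B\cup\{B\}$ has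 property (T) and for every $k\in\mathbb N$: (B.1) $B\cap H_{n_k}\in\mathcal C$, (B.2) $|\nu_{n_{2k}}(B\cap H_{n_{2k}})|\le 0.1$, (B.3) $|\nu_{n_{2k+1}}(B\cap H_{n_{2k+1}})|\ge 0.3$. -/

import Mathlib

open MeasureTheory
open scoped Cardinal

namespace CantorT

/-! ### Martin's axiom for σ-centered posets -/

/-- A subset of a poset is centered if each of its nonempty finite subsets has a lower bound in
the poset. -/
def IsCenteredSet {P : Type*} [PartialOrder P] (S : Set P) : Prop :=
  ∀ F : Finset P, F.Nonempty → (F : Set P) ⊆ S → ∃ e : P, ∀ x ∈ F, e ≤ x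

/-- A poset is σ-centered if it is a countable union of centered sets. -/
def IsSigmaCentered (P : Type*) [PartialOrder P] : Prop :=
  ∃ S : ℕ → Set P, (⋃ i, S i) = Set.univ ∧ ∀ i, IsCenteredSet (S i)

/-- A subset of a poset is dense (in the sense of forcing) if it has an element below each element
of the poset. -/
def IsDenseSet {P : Type*} [PartialOrder P] (D : Set P) : Prop :=
  ∀ p : P, ∃ d ∈ D, d ≤ p

/-- `MA(σ-centered)`: for every nonempty σ-centered poset `P` and every family of fewer than `𝔠`
dense subsets of `P`, some filter in `P` meets all members of the family. -/
def MASigmaCentered : Prop :=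
  ∀ (P : Type) [PartialOrder P] [Nonempty P], IsSigmaCentered P →
    ∀ 𝒟 : Set (Set P), #𝒟 < 𝔠 → (∀ D ∈ 𝒟, IsDenseSet D) →
      ∃ G : Order.PFilter P, ∀ D ∈ 𝒟, ∃ x ∈ D, x ∈ G

/-! ### Bounded finitely additive measures on Boolean algebras -/

/-- The bounded finitely additive real-valued (signed) measures on a Boolean algebra. -/
structure BA (α : Type*) [BooleanAlgebra α] where
  toFun : α → ℝ
  map_sup' : ∀ a b : α, Disjoint a b → toFun (a ⊔ b) = toFun a + toFun b
  bounded' : ∃ M : ℝ, ∀ a : α, |toFun a| ≤ M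

namespace BA

variable {α : Type*} [BooleanAlgebra α]

instance : CoeFun (BA α) (fun _ => α → ℝ) := ⟨toFun⟩

/-- The variation `|μ|(a)`: the supremum of `∑ |μ(b)|` over all finite partitions of `a`. -/
noncomputable def variation (μ : BA α) (a : α) : ℝ :=
  ⨆ P : Finpartition a, ∑ b ∈ P.parts, |μ b|

/-- The total variation norm `‖μ‖ = |μ|(1)`. -/
noncomputable def totalVariation (μ : BA α) : ℝ := μ.variation ⊤

theorem map_bot (μ : BA α) : μ ⊥ = 0 := by
  have h := μ.map_sup' ⊥ ⊥ disjoint_bot_left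
  rw [sup_bot_eq] at h
  linarith

theorem map_finset_sup (μ : BA α) (s : Finset α) (hs : (s : Set α).PairwiseDisjoint id) :
    μ (s.sup id) = ∑ b ∈ s, μ b := by
  classical
  induction s using Finset.induction_on with
  | empty => simpa using μ.map_bot
  | insert a s ha ih =>
    rw [Finset.sup_insert, Finset.sum_insert ha, ← ih (hs.subset (by simp))]
    refine μ.map_sup' _ _ ?_
    rw [Finset.disjoint_sup_right]
    intro b hb
    exact hs (by simp) (by simp [hb]) (fun h => ha (h ▸ hb))

/-- The supremum in the definition of the variation is that of a bounded set of reals. -/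
theorem bddAbove_variation (μ : BA α) (a : α) :
    BddAbove (Set.range fun P : Finpartition a => ∑ b ∈ P.parts, |μ b|) := by
  classical
  obtain ⟨M, hM⟩ := μ.bounded'
  refine ⟨M + M, ?_⟩
  rintro _ ⟨P, rfl⟩
  have hd : ∀ (p : α → Prop) [DecidablePred p], ((P.parts.filter p : Finset α) : Set α).PairwiseDisjoint id :=
    fun p _ => P.disjoint.subset fun x hx => (Finset.mem_filter.1 hx).1
  have h1 := μ.map_finset_sup _ (hd fun b => 0 ≤ μ b)
  have h2 := μ.map_finset_sup _ (hd fun b => ¬ 0 ≤ μ b)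
  have e1 : ∑ b ∈ P.parts.filter (fun b => 0 ≤ μ b), |μ b|
      = ∑ b ∈ P.parts.filter (fun b => 0 ≤ μ b), μ b :=
    Finset.sum_congr rfl fun b hb => abs_of_nonneg (Finset.mem_filter.1 hb).2
  have e2 : ∑ b ∈ P.parts.filter (fun b => ¬ 0 ≤ μ b), |μ b|
      = - ∑ b ∈ P.parts.filter (fun b => ¬ 0 ≤ μ b), μ b := by
    rw [← Finset.sum_neg_distrib]
    exact Finset.sum_congr rfl fun b hb =>
      abs_of_neg (not_le.1 (Finset.mem_filter.1 hb).2)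
  have b1 := (abs_le.1 (hM ((P.parts.filter fun b => 0 ≤ μ b).sup id))).2
  have b2 := (abs_le.1 (hM ((P.parts.filter fun b => ¬ 0 ≤ μ b).sup id))).1
  change ∑ b ∈ P.parts, |μ b| ≤ M + M
  rw [← Finset.sum_filter_add_sum_filter_not P.parts (fun b => 0 ≤ μ b), e1, e2, ← h1, ← h2]
  linarith

end BA

/-! ### The Cantor space and property (T) -/

/-- The Cantor space `2^ℕ`, with the product topology and its Borel σ-field. -/
abbrev Cantor : Type := ℕ → Bool

/-- The standard product probability measure `λ` on the Cantor space. -/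
noncomputable def lam : Measure Cantor :=
  Measure.infinitePi fun _ : ℕ => (PMF.uniformOfFintype Bool).toMeasure

/-- The clopen set `V_m^i = {x : x(m) = i}`, where `false` and `true` stand for `0` and `1`. -/
def V (m : ℕ) (i : Bool) : Set Cantor := {x | x m = i}

/-- The finite algebra `𝒜_n` generated by the sets `V_m^i` with `0 ≤ m ≤ n` and `i = 0, 1`. -/
def cylAlg (n : ℕ) : BooleanSubalgebra (Set Cantor) :=
  BooleanSubalgebra.closure {W | ∃ m ≤ n, ∃ i : Bool, W = V m i}

/-- `φ_n(A) = |λ(A ∩ V_n^0) - λ(A ∩ V_n^1)|`. -/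
noncomputable def phi (n : ℕ) (A : Set Cantor) : ℝ :=
  |lam.real (A ∩ V n false) - lam.real (A ∩ V n true)|

/-- A Boolean algebra `ℬ` of subsets of the Cantor space has property (T): it consists of Borel
sets, contains all clopen sets, and each finite family of its members satisfies conditions (T.1)
and (T.2), for each `ε > 0`, with respect to some `n > 0`. -/
structure PropertyT (ℬ : BooleanSubalgebra (Set Cantor)) : Prop where
  borel : ∀ A ∈ ℬ, MeasurableSet A
  clopen : ∀ A : Set Cantor, IsClopen A → A ∈ ℬ
  approx : ∀ F : Finset (Set Cantor), (∀ A ∈ F, A ∈ ℬ) → ∀ ε : ℝ, 0 < ε →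
    ∃ n : ℕ, 0 < n ∧ ∀ U : cylAlg n, IsAtom U → ∀ A ∈ F,
      (lam.real (A ∩ U) ≤ ε * lam.real (U : Set Cantor) / n ∨
        lam.real ((U : Set Cantor) \ A) ≤ ε * lam.real (U : Set Cantor) / n) ∧
      ∀ m : ℕ, n < m → phi m (A ∩ U) ≤ ε * lam.real (U : Set Cantor) / m

end CantorT

/-!
The set `B` is a limit in measure of sets `D ∈ 𝒞` supplied by a filter in a σ-centered poset. A condition
consists of an approximation `D`, finitely many indices `i` for which the trace `B ∩ H i = D ∩ H i` is
decided, and finitely many promises. A promise says that certain sets `(A₁ ∩ D) ∪ (A₂ \ D)` with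
`A₁, A₂ ∈ ℬ` satisfy (T.1) and (T.2) at a fixed level with a constant strictly below `ε`, and that `D`
stays `ε`-close to a fixed set. Conditions with the same `D` and the same decided indices are
compatible, and `𝒞` is countable, so the poset is σ-centered. Since (T.1) and (T.2) at a fixed level are
closed under limits in measure, promises are inherited by `B`, and every finite part of the algebra
generated by `ℬ` and `B` is controlled by some promise. Fewer than `𝔠` dense sets suffice because
`|ℬ| < 𝔠`: those that contain a promise for given `A₁, A₂, …` and `ε` are dense by property (T) of `ℬ`,
and there remain countably many that decide a late trace `B ∩ H i` to be empty, or to be a prescribed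
`E i ⊆ H i` with `|ν i (E i)| ≥ 0.3`; such an `E i` is the positive or negative part of a partition of `H i`
that nearly attains the variation.

The heart of the matter is the density of the last two kinds, `Condition.exists_le_decided`: for large
`i`, the trace of `D` on `H i` can be changed arbitrarily without breaking a promise. As `λ(H i) → 0`, the
change is harmless for (T.1) and for (T.2) in bounded coordinates, but in the remaining coordinates `m`
its imbalance has to be far below `λ(H i)`. It is cancelled by a further small change outside `H i`
(`exists_balanced_modification`). Property (T) provides, in each atom `Q` of positive measure of the finite
algebra that matters, a cylinder which is almost contained in `Q`. At a much finer level `N`, where `Q` is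
up to a negligible error a union of cylinders, `exists_balancing_finset` selects few of those cylinders so
that the total imbalance is negligible in all coordinates up to `N`; beyond `N` the members of `ℬ` are
balanced anyway. A fractional selection exists by the Hahn-Banach theorem: the functional to be
cancelled is bounded by `λ(H i)^(1/2) ‖w‖₂` in the direction `w`, while Khinchine's inequality bounds the
mean of the positive part of a Rademacher sum from below by a multiple of `‖w‖₂`, even on a subset of
almost full measure. An extreme point of the polytope of fractional selections has at most one more
fractional coordinate than there are balancing equations, so rounding it is harmless.
-/

namespace CantorT

/-! ### Balancing in finite cubes -/

/-- Hahn-Banach in finite dimensions: `c` is a combination of the vectors `a t` with weights in `[0, δ]`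
if each linear functional `w` is at most as large at `c` as its supremum over these combinations. -/
theorem exists_weights_of_support_le {κ ι : Type*} [Fintype κ] [Fintype ι]
    (a : κ → ι → ℝ) (c : ι → ℝ) {δ : ℝ} (hδ : 0 ≤ δ)
    (h : ∀ w : ι → ℝ, ∑ i, w i * c i ≤ δ * ∑ t, max (∑ i, w i * a t i) 0) :
    ∃ f : κ → ℝ, (∀ t, 0 ≤ f t ∧ f t ≤ δ) ∧ ∀ i, ∑ t, f t * a t i = c i := by
  classical
  let L : (κ → ℝ) →ₗ[ℝ] (ι → ℝ) :=
    { toFun := fun f i => ∑ t, f t * a t i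
      map_add' := fun f g => by ext i; simp [add_mul, Finset.sum_add_distrib]
      map_smul' := fun r f => by ext i; simp [mul_assoc, Finset.mul_sum] }
  have hL : Continuous L := L.continuous_of_finiteDimensional
  by_contra hcon
  have hc : c ∉ L '' Set.Icc 0 (fun _ => δ) := by
    rintro ⟨f, hf, rfl⟩
    exact hcon ⟨f, fun t => ⟨hf.1 t, hf.2 t⟩, fun i => rfl⟩
  have hconv : Convex ℝ (L '' Set.Icc 0 (fun _ => δ)) := (convex_Icc _ _).linear_image L
  have hclosed : IsClosed (L '' Set.Icc 0 (fun _ => δ)) := (isCompact_Icc.image hL).isClosed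
  obtain ⟨φ, u, h1, h2⟩ := geometric_hahn_banach_closed_point hconv hclosed hc
  have hφ : ∀ z : ι → ℝ, φ z = ∑ i, φ (Pi.single i 1) * z i := by
    intro z
    conv_lhs => rw [pi_eq_sum_univ' z]
    simp [map_sum, mul_comm]
  set w : ι → ℝ := fun i => φ (Pi.single i 1)
  have h3 := h w
  -- the weights at which the functional `w` attains its supremum
  let f : κ → ℝ := fun t => if 0 ≤ ∑ i, w i * a t i then δ else 0
  have hf : f ∈ Set.Icc (0 : κ → ℝ) (fun _ => δ) := by
    constructor <;> intro t <;> simp only [f] <;> split_ifs <;> simp [hδ]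
  have h4 := h1 (L f) ⟨f, hf, rfl⟩
  rw [hφ] at h4 h2
  have h5 : ∑ i, φ (Pi.single i 1) * L f i = δ * ∑ t, max (∑ i, w i * a t i) 0 := by
    change ∑ i, w i * ∑ t, f t * a t i = _
    simp_rw [Finset.mul_sum]
    rw [Finset.sum_comm]
    refine Finset.sum_congr rfl fun t _ => ?_
    simp only [f]
    split_ifs with ht
    · rw [max_eq_left ht, Finset.mul_sum]
      exact Finset.sum_congr rfl fun i _ => by ring
    · rw [max_eq_right (not_le.1 ht).le]
      simp
  rw [h5] at h4
  linarith

/-- Rounding: the fractional coordinates of an extreme point of a polytope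
`{f ∈ [0,1]^κ : ∑ f a = const}` are at most as many as the equations. -/
theorem exists_weights_card_fractional_le {κ ι : Type*} [Fintype κ] [Fintype ι]
    (a : κ → ι → ℝ) (f : κ → ℝ) (hf : ∀ t, 0 ≤ f t ∧ f t ≤ 1) :
    ∃ g : κ → ℝ, (∀ t, 0 ≤ g t ∧ g t ≤ 1) ∧ (∀ i, ∑ t, g t * a t i = ∑ t, f t * a t i) ∧
      (Finset.univ.filter fun t => g t ≠ 0 ∧ g t ≠ 1).card ≤ Fintype.card ι := by
  classical
  let L : (κ → ℝ) →ₗ[ℝ] (ι → ℝ) :=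
    { toFun := fun f i => ∑ t, f t * a t i
      map_add' := fun f g => by ext i; simp [add_mul, Finset.sum_add_distrib]
      map_smul' := fun r f => by ext i; simp [mul_assoc, Finset.mul_sum] }
  have hL : Continuous L := L.continuous_of_finiteDimensional
  let K : Set (κ → ℝ) := Set.Icc 0 1 ∩ L ⁻¹' {L f}
  have hK : IsCompact K := isCompact_Icc.inter_right (isClosed_singleton.preimage hL)
  obtain ⟨g, hg⟩ := hK.extremePoints_nonempty ⟨f, ⟨fun t => (hf t).1, fun t => (hf t).2⟩, rfl⟩
  have hgK := hg.1
  refine ⟨g, fun t => ⟨hgK.1.1 t, hgK.1.2 t⟩, fun i => congrFun hgK.2 i, ?_⟩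
  by_contra! hcard
  set Φ := Finset.univ.filter fun t => g t ≠ 0 ∧ g t ≠ 1
  let E : (Φ → ℝ) →ₗ[ℝ] (κ → ℝ) := LinearMap.funLeft ℝ ℝ (fun t : κ => t) ∘ₗ
    { toFun := fun v t => if h : t ∈ Φ then v ⟨t, h⟩ else 0
      map_add' := fun v w => by ext t; by_cases h : t ∈ Φ <;> simp [h]
      map_smul' := fun r v => by ext t; by_cases h : t ∈ Φ <;> simp [h] }
  have hE1 : ∀ v t, t ∉ Φ → E v t = 0 := fun v t h => by
    simp [E, LinearMap.funLeft, h]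
  have hE2 : ∀ v (t : Φ), E v t = v t := fun v t => by
    simp [E, LinearMap.funLeft]
  have hker : LinearMap.ker (L ∘ₗ E) ≠ ⊥ :=
    LinearMap.ker_ne_bot_of_finrank_lt (by simpa using hcard)
  obtain ⟨v, hv, hv0⟩ := (Submodule.ne_bot_iff _).1 hker
  have hv' : L (E v) = 0 := hv
  have hev : ∀ᶠ ε : ℝ in nhdsWithin 0 (Set.Ioi 0), ∀ t : κ, t ∈ Φ →
      ε * |E v t| < g t ∧ ε * |E v t| < 1 - g t := by
    refine Filter.eventually_all.2 fun t => ?_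
    by_cases ht : t ∈ Φ
    · have h0 : 0 < g t := lt_of_le_of_ne (hgK.1.1 t) (Ne.symm (Finset.mem_filter.1 ht).2.1)
      have h1 : 0 < 1 - g t :=
        sub_pos.2 (lt_of_le_of_ne (hgK.1.2 t) (Finset.mem_filter.1 ht).2.2)
      have hlim : Filter.Tendsto (fun ε : ℝ => ε * |E v t|) (nhdsWithin 0 (Set.Ioi 0))
          (nhds 0) := by
        have : Filter.Tendsto (fun ε : ℝ => ε * |E v t|) (nhds 0) (nhds (0 * |E v t|)) :=
          (continuous_id.mul continuous_const).tendsto 0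
        rw [zero_mul] at this
        exact this.mono_left nhdsWithin_le_nhds
      filter_upwards [hlim.eventually_lt_const h0, hlim.eventually_lt_const h1] with ε a b _
      exact ⟨a, b⟩
    · exact Filter.Eventually.of_forall fun ε h => absurd h ht
  obtain ⟨ε, hε, hε0⟩ := (hev.and self_mem_nhdsWithin).exists
  have hε0 : 0 < ε := hε0
  have hmem : ∀ σ : ℝ, |σ| = ε → g + σ • E v ∈ K := by
    intro σ hσ
    have hb : ∀ t, 0 ≤ g t + σ * E v t ∧ g t + σ * E v t ≤ 1 := by
      intro t
      by_cases ht : t ∈ Φ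
      · have h1 := hε t ht
        have h2 : |σ * E v t| = ε * |E v t| := by rw [abs_mul, hσ]
        have h3 := abs_le.1 h2.le
        constructor <;> linarith
      · rw [hE1 v t ht]
        simpa using ⟨hgK.1.1 t, hgK.1.2 t⟩
    refine ⟨⟨fun t => (hb t).1, fun t => (hb t).2⟩, ?_⟩
    change L (g + σ • E v) = L f
    rw [map_add, map_smul, hv', smul_zero, add_zero]
    exact hgK.2
  have hseg : g ∈ openSegment ℝ (g + ε • E v) (g + (-ε) • E v) := by
    refine ⟨1 / 2, 1 / 2, by norm_num, by norm_num, by norm_num, ?_⟩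
    module
  have heq := hg.2 (hmem ε (abs_of_pos hε0)) (hmem (-ε) (by rw [abs_neg, abs_of_pos hε0])) hseg
  apply hv0
  ext t
  have h1 : ε * E v t = 0 := by simpa using congrFun heq (t : κ)
  rw [hE2] at h1
  simpa [hε0.ne'] using h1

/-- Weights in `[0, 1]` can be rounded to a set without increasing the total weight, with an error of at
most one per equation. -/
theorem exists_finset_of_weights {κ ι : Type*} [Fintype κ] [Fintype ι]
    (a : κ → ι → ℝ) (ha : ∀ t i, |a t i| ≤ 1) (f : κ → ℝ) (hf : ∀ t, 0 ≤ f t ∧ f t ≤ 1) :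
    ∃ S : Finset κ, (S.card : ℝ) ≤ ∑ t, f t ∧
      ∀ i, |∑ t ∈ S, a t i - ∑ t, f t * a t i| ≤ Fintype.card ι + 1 := by
  classical
  -- the additional equation `none` preserves the total weight
  obtain ⟨g, hg, hga, hcard⟩ := exists_weights_card_fractional_le
    (fun t (i : Option ι) => i.elim 1 (a t)) f hf
  have hsum : ∑ t, g t = ∑ t, f t := by simpa using hga none
  have hga' : ∀ i, ∑ t, g t * a t i = ∑ t, f t * a t i := fun i => hga (some i)
  rw [Fintype.card_option] at hcard
  set Φ := Finset.univ.filter fun t => g t ≠ 0 ∧ g t ≠ 1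
  refine ⟨Finset.univ.filter fun t => g t = 1, ?_, fun i => ?_⟩
  · rw [← hsum, Finset.card_eq_sum_ones, Nat.cast_sum, Finset.sum_filter]
    refine Finset.sum_le_sum fun t _ => ?_
    split_ifs with h
    · simp [h]
    · exact (hg t).1
  · have h1 : ∑ t with g t = 1, a t i - ∑ t, g t * a t i = -∑ t ∈ Φ, g t * a t i := by
      rw [Finset.sum_filter, Finset.sum_filter, ← Finset.sum_sub_distrib,
        ← Finset.sum_neg_distrib]
      refine Finset.sum_congr rfl fun t _ => ?_
      by_cases h1 : g t = 1
      · simp [h1]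
      · by_cases h0 : g t = 0
        · simp [h0]
        · simp [h0, h1]
    rw [← hga', h1, abs_neg]
    calc |∑ t ∈ Φ, g t * a t i| ≤ ∑ t ∈ Φ, |g t * a t i| := Finset.abs_sum_le_sum_abs _ _
      _ ≤ ∑ t ∈ Φ, (1 : ℝ) := by
        refine Finset.sum_le_sum fun t _ => ?_
        rw [abs_mul, abs_of_nonneg (hg t).1]
        exact mul_le_one₀ (hg t).2 (abs_nonneg _) (ha t i)
      _ ≤ Fintype.card ι + 1 := by
        simp only [Finset.sum_const, nsmul_eq_mul, mul_one]
        exact_mod_cast hcard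

/-- The Rademacher sign of a bit: `1` for `false` and `-1` for `true`. -/
def sgn (b : Bool) : ℝ := if b then -1 else 1

@[simp] theorem sgn_not (b : Bool) : sgn (!b) = -sgn b := by cases b <;> simp [sgn]

@[simp] theorem sgn_sq (b : Bool) : sgn b ^ 2 = 1 := by cases b <;> simp [sgn]

@[simp] theorem abs_sgn (b : Bool) : |sgn b| = 1 := by cases b <;> simp [sgn]

section Moments

variable {ι : Type*} [DecidableEq ι]

/-- The reflection of the cube `2^ι` in the coordinate `k`. -/
def flip (k : ι) (s : ι → Bool) : ι → Bool := Function.update s k (!s k)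

theorem flip_flip (k : ι) (s : ι → Bool) : flip k (flip k s) = s := by
  ext i
  by_cases h : i = k <;> simp [flip, Function.update, h]

theorem flip_same (k : ι) (s : ι → Bool) : flip k s k = !s k := by simp [flip]

theorem flip_of_ne {i k : ι} (h : i ≠ k) (s : ι → Bool) : flip k s i = s i := by simp [flip, h]

/-- Each Rademacher sign is orthogonal to the functions that do not depend on its coordinate. -/
theorem sum_mul_sgn_eq_zero {U : Finset (ι → Bool)} {k : ι} (hU : ∀ s ∈ U, flip k s ∈ U)
    (g : (ι → Bool) → ℝ) (hg : ∀ s, g (flip k s) = g s) : ∑ s ∈ U, g s * sgn (s k) = 0 := by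
  have h : ∑ s ∈ U, g s * sgn (s k) = ∑ s ∈ U, -(g s * sgn (s k)) := by
    refine Finset.sum_nbij' (flip k) (flip k) hU hU (fun s _ => flip_flip k s)
      (fun s _ => flip_flip k s) fun s _ => ?_
    rw [hg, flip_same, sgn_not]
    ring
  rw [Finset.sum_neg_distrib] at h
  linarith

/-- The Rademacher sum with weights `w` over the coordinates in `M`. -/
def rad (w : ι → ℝ) (M : Finset ι) (s : ι → Bool) : ℝ := ∑ i ∈ M, w i * sgn (s i)

/-- The first, second and fourth moments of a Rademacher sum, over a set of points of the cube that
is invariant under the reflections in all coordinates involved. -/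
theorem rad_moments (w : ι → ℝ) (U : Finset (ι → Bool)) (M : Finset ι)
    (hU : ∀ k ∈ M, ∀ s ∈ U, flip k s ∈ U) :
    ∑ s ∈ U, rad w M s = 0 ∧ ∑ s ∈ U, rad w M s ^ 2 = U.card * ∑ i ∈ M, w i ^ 2 ∧
      ∑ s ∈ U, rad w M s ^ 4 ≤ 3 * (U.card * (∑ i ∈ M, w i ^ 2) ^ 2) := by
  induction M using Finset.induction_on with
  | empty => simp [rad]
  | insert k M hk ih =>
    obtain ⟨h1, h2, h4⟩ := ih fun j hj => hU j (Finset.mem_insert_of_mem hj)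
    have hUk := hU k (Finset.mem_insert_self k M)
    have hflip : ∀ s, rad w M (flip k s) = rad w M s := fun s =>
      Finset.sum_congr rfl fun i hi => by rw [flip_of_ne (ne_of_mem_of_not_mem hi hk)]
    have hins : ∀ s, rad w (insert k M) s = rad w M s + w k * sgn (s k) := fun s => by
      rw [rad, Finset.sum_insert hk, add_comm, rad]
    have o0 := sum_mul_sgn_eq_zero hUk (fun _ => (1 : ℝ)) (fun _ => rfl)
    have o1 := sum_mul_sgn_eq_zero hUk (fun s => rad w M s) hflip
    have o3 := sum_mul_sgn_eq_zero hUk (fun s => rad w M s ^ 3) (fun s => by rw [hflip])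
    simp only [one_mul] at o0
    refine ⟨?_, ?_, ?_⟩
    · simp_rw [hins, Finset.sum_add_distrib, ← Finset.mul_sum]
      rw [h1, o0]; simp
    · have e : ∀ s, rad w (insert k M) s ^ 2
          = rad w M s ^ 2 + 2 * w k * (rad w M s * sgn (s k)) + w k ^ 2 := fun s => by
        rw [hins]
        linear_combination w k ^ 2 * sgn_sq (s k)
      simp_rw [e, Finset.sum_add_distrib, ← Finset.mul_sum]
      rw [o1, h2, Finset.sum_insert hk]
      simp only [Finset.sum_const, nsmul_eq_mul]
      ring
    · have e : ∀ s, rad w (insert k M) s ^ 4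
          = rad w M s ^ 4 + 4 * w k * (rad w M s ^ 3 * sgn (s k))
            + 6 * w k ^ 2 * rad w M s ^ 2 + 4 * w k ^ 3 * (rad w M s * sgn (s k))
            + w k ^ 4 := fun s => by
        rw [hins]
        linear_combination (6 * rad w M s ^ 2 * w k ^ 2 + 4 * rad w M s * w k ^ 3 * sgn (s k)
          + w k ^ 4 * (sgn (s k) ^ 2 + 1)) * sgn_sq (s k)
      simp_rw [e, Finset.sum_add_distrib, ← Finset.mul_sum]
      rw [o1, o3, h2, Finset.sum_insert hk]
      simp only [Finset.sum_const, nsmul_eq_mul]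
      have hw : 0 ≤ (U.card : ℝ) * w k ^ 4 := by positivity
      nlinarith

variable [Fintype ι]

/-- A reversed Cauchy-Schwarz (Khinchine) bound: the positive part of a Rademacher sum has a large
mean over an invariant set `U`, even after a fiftieth of `U` is removed. -/
theorem le_sum_max_rad {w : ι → ℝ} {U G : Finset (ι → Bool)} {M : Finset ι}
    (hU : ∀ k ∈ M, ∀ s ∈ U, flip k s ∈ U) (hGU : G ⊆ U)
    (hG : 50 * ((U \ G).card : ℝ) ≤ U.card) {σ : ℝ} (hσ : 0 < σ) (hw : ∑ i ∈ M, w i ^ 2 = σ ^ 2) :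
    U.card * σ / 8 ≤ ∑ s ∈ G, max (rad w M s) 0 := by
  obtain ⟨h1, h2, h4⟩ := rad_moments w U M hU
  rw [hw] at h2 h4
  -- equality holds at `|z| = 3σ/2`, so the first mean of `|z|` is bounded below by the moments
  have p1 : ∀ z : ℝ, z ^ 2 / σ - 4 / 27 * z ^ 4 / σ ^ 3 ≤ |z| := by
    intro z
    have hz := abs_nonneg z
    set a := |z| with ha
    rw [← sq_abs z, ← (Even.pow_abs (by decide : Even 4) z), ← ha]
    have key : 0 ≤ a * ((a - 3 / 2 * σ) ^ 2 * (a + 3 * σ)) := by positivity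
    rw [div_sub_div _ _ hσ.ne' (by positivity), div_le_iff₀ (by positivity)]
    nlinarith [mul_nonneg hσ.le key]
  have p2 : ∀ z : ℝ, max z 0 = (z + |z|) / 2 := by
    intro z
    rcases le_total 0 z with h | h
    · rw [max_eq_left h, abs_of_nonneg h]; ring
    · rw [max_eq_right h, abs_of_nonpos h]; ring
  -- a weighted Cauchy-Schwarz bound for the removed part
  have p3 : ∀ z : ℝ, max z 0 ≤ z ^ 2 / (14 * σ) + 7 * σ / 2 := by
    intro z
    refine max_le ?_ (by positivity)
    rw [div_add' _ _ _ (by positivity), le_div_iff₀ (by positivity)]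
    nlinarith [sq_nonneg (z - 7 * σ)]
  have q1 : U.card * σ * (5 / 18) ≤ ∑ s ∈ U, max (rad w M s) 0 := by
    have : ∑ s ∈ U, (rad w M s ^ 2 / σ - 4 / 27 * rad w M s ^ 4 / σ ^ 3)
        ≤ ∑ s ∈ U, |rad w M s| := Finset.sum_le_sum fun s _ => p1 _
    simp_rw [p2, ← Finset.sum_div, Finset.sum_add_distrib]
    rw [h1]
    rw [Finset.sum_sub_distrib, ← Finset.sum_div, ← Finset.sum_div, ← Finset.mul_sum, h2] at this
    have h5 : (4 / 27 * ∑ s ∈ U, rad w M s ^ 4) / σ ^ 3 ≤ 4 / 9 * (U.card * σ) := by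
      rw [div_le_iff₀ (by positivity)]
      linarith
    have h6 : (U.card : ℝ) * σ ^ 2 / σ = U.card * σ := by field_simp
    linarith
  have q2 : ∑ s ∈ U \ G, max (rad w M s) 0 ≤ U.card * σ * (1 / 14 + 7 / 100) := by
    calc ∑ s ∈ U \ G, max (rad w M s) 0
        ≤ ∑ s ∈ U \ G, (rad w M s ^ 2 / (14 * σ) + 7 * σ / 2) :=
          Finset.sum_le_sum fun s _ => p3 _
      _ = (∑ s ∈ U \ G, rad w M s ^ 2) / (14 * σ) + (U \ G).card * (7 * σ / 2) := by
          rw [Finset.sum_add_distrib, ← Finset.sum_div]; simp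
      _ ≤ (∑ s ∈ U, rad w M s ^ 2) / (14 * σ) + (U \ G).card * (7 * σ / 2) := by
          gcongr
          exact Finset.sdiff_subset
      _ ≤ U.card * σ * (1 / 14 + 7 / 100) := by
          rw [h2]
          have : (U.card : ℝ) * σ ^ 2 / (14 * σ) = U.card * σ / 14 := by field_simp
          rw [this]
          nlinarith
  have q3 := Finset.sum_sdiff (f := fun s => max (rad w M s) 0) hGU
  have q4 : 0 ≤ (U.card : ℝ) * σ := by positivity
  linarith

/-- A small mass `y` on the cube can be balanced, in all coordinates of `M` up to a bounded number of
points, by a small subset `S` of a prescribed large part `G` of a subcube `U`. The fractional version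
holds by the Hahn-Banach theorem, since the mean of the positive part of each Rademacher sum over `G`
dominates its `L²` norm; the constant `64 = 8²` is that of `le_sum_max_rad`. -/
theorem exists_balancing_finset {U G : Finset (ι → Bool)} {M : Finset ι}
    (hU : ∀ k ∈ M, ∀ s ∈ U, flip k s ∈ U) (hGU : G ⊆ U)
    (hG : 50 * ((U \ G).card : ℝ) ≤ U.card) {y : (ι → Bool) → ℝ} (hy : ∀ s, 0 ≤ y s ∧ y s ≤ 1)
    {δ : ℝ} (hδ : 0 ≤ δ) (hδ1 : δ ≤ 1)
    (hyδ : 64 * ((∑ s, y s) * 2 ^ Fintype.card ι) ≤ (δ * U.card) ^ 2) :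
    ∃ S ⊆ G, (S.card : ℝ) ≤ δ * G.card ∧
      ∀ m ∈ M, |∑ s, y s * sgn (s m) + ∑ s ∈ S, sgn (s m)| ≤ M.card + 1 := by
  have hsupp : ∀ w : M → ℝ, ∑ i, w i * (-∑ s, y s * sgn (s i))
      ≤ δ * ∑ t : G, max (∑ i, w i * sgn (t.1 i)) 0 := by
    intro w
    let w' : ι → ℝ := fun i => if h : i ∈ M then w ⟨i, h⟩ else 0
    have hw' : ∀ i : M, w' i = w i := fun i => by simp [w']
    have hrad : ∀ s, ∑ i, w i * sgn (s i) = rad w' M s := fun s => by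
      rw [rad, ← Finset.sum_coe_sort M]
      exact Finset.sum_congr rfl fun i _ => by rw [hw']
    simp_rw [hrad]
    rw [Finset.sum_coe_sort G (fun s => max (rad w' M s) 0)]
    have hL : ∑ i, w i * (-∑ s, y s * sgn (s i)) = -∑ s, y s * rad w' M s := by
      simp_rw [← hrad, mul_neg, Finset.sum_neg_distrib, Finset.mul_sum]
      rw [Finset.sum_comm]
      simp_rw [mul_left_comm]
    rw [hL]
    have hUnn : (0 : ℝ) ≤ U.card := Nat.cast_nonneg _
    obtain ⟨σ, hσ0, hσ⟩ : ∃ σ : ℝ, 0 ≤ σ ∧ ∑ i ∈ M, w' i ^ 2 = σ ^ 2 :=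
      ⟨√(∑ i ∈ M, w' i ^ 2), Real.sqrt_nonneg _,
        (Real.sq_sqrt (Finset.sum_nonneg fun _ _ => sq_nonneg _)).symm⟩
    have hlow : U.card * σ / 8 ≤ ∑ s ∈ G, max (rad w' M s) 0 := by
      rcases hσ0.eq_or_lt with h | h
      · have h0 : (0 : ℝ) ≤ ∑ s ∈ G, max (rad w' M s) 0 :=
          Finset.sum_nonneg fun s _ => le_max_right _ _
        simpa [← h] using h0
      · exact le_sum_max_rad hU hGU hG h hσ
    have hcs : (∑ s, y s * rad w' M s) ^ 2 ≤ (δ * (U.card * σ / 8)) ^ 2 := by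
      have h2 := (rad_moments w' Finset.univ M fun _ _ _ _ => Finset.mem_univ _).2.1
      rw [hσ, Finset.card_univ, Fintype.card_fun, Fintype.card_bool] at h2
      push_cast at h2
      calc (∑ s, y s * rad w' M s) ^ 2
          ≤ (∑ s, y s ^ 2) * ∑ s, rad w' M s ^ 2 := Finset.sum_mul_sq_le_sq_mul_sq _ _ _
        _ ≤ (∑ s, y s) * ∑ s, rad w' M s ^ 2 := by
            refine mul_le_mul_of_nonneg_right (Finset.sum_le_sum fun s _ => ?_)
              (Finset.sum_nonneg fun _ _ => sq_nonneg _)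
            nlinarith [hy s]
        _ ≤ (δ * (U.card * σ / 8)) ^ 2 := by
            rw [h2]
            nlinarith [mul_le_mul_of_nonneg_right hyδ (sq_nonneg σ)]
    have := abs_le_of_sq_le_sq hcs (by positivity)
    have := mul_le_mul_of_nonneg_left hlow hδ
    linarith [neg_le_abs (∑ s, y s * rad w' M s)]
  obtain ⟨f, hf, hfa⟩ := exists_weights_of_support_le
    (fun (t : G) (i : M) => sgn (t.1 i)) (fun i => -∑ s, y s * sgn (s i)) hδ hsupp
  obtain ⟨S, hS, hSa⟩ := exists_finset_of_weights (fun (t : G) (i : M) => sgn (t.1 i))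
    (fun t i => (abs_sgn _).le) f fun t => ⟨(hf t).1, (hf t).2.trans hδ1⟩
  refine ⟨S.map (Function.Embedding.subtype _), ?_, ?_, fun m hm => ?_⟩
  · intro s hs
    obtain ⟨t, _, rfl⟩ := Finset.mem_map.1 hs
    exact t.2
  · rw [Finset.card_map]
    refine hS.trans ((Finset.sum_le_sum fun t _ => (hf t).2).trans ?_)
    simp [mul_comm]
  · have h := hSa ⟨m, hm⟩
    rw [hfa] at h
    rw [Finset.sum_map]
    simp only [Fintype.card_coe] at h
    rw [add_comm, ← sub_neg_eq_add]
    exact h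

end Moments

/-! ### Cylinders and signed imbalances -/

instance : IsProbabilityMeasure lam := by
  unfold lam
  infer_instance

/-- The cylinder of all points whose first `N` bits are given by `s`. -/
def cyl (N : ℕ) (s : Fin N → Bool) : Set Cantor := {x | ∀ i : Fin N, x i = s i}

theorem isClopen_V (m : ℕ) (i : Bool) : IsClopen (V m i) :=
  (isClopen_discrete {i}).preimage (continuous_apply m)

theorem measurableSet_V (m : ℕ) (i : Bool) : MeasurableSet (V m i) :=
  (isClopen_V m i).isOpen.measurableSet

theorem cyl_eq_iInter (N : ℕ) (s : Fin N → Bool) : cyl N s = ⋂ i : Fin N, V i (s i) := by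
  ext x
  simp [cyl, V]

theorem isClopen_cyl (N : ℕ) (s : Fin N → Bool) : IsClopen (cyl N s) := by
  rw [cyl_eq_iInter]
  exact isClopen_iInter_of_finite fun i => isClopen_V _ _

theorem measurableSet_cyl (N : ℕ) (s : Fin N → Bool) : MeasurableSet (cyl N s) :=
  (isClopen_cyl N s).isOpen.measurableSet

theorem lam_real_cyl (N : ℕ) (s : Fin N → Bool) : lam.real (cyl N s) = (1 / 2) ^ N := by
  have h : cyl N s = Set.pi (Finset.range N)
      (fun i => if h : i < N then {s ⟨i, h⟩} else Set.univ) := by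
    ext x
    simp only [cyl, Set.mem_ofPred_eq, Set.mem_pi, Finset.coe_range, Set.mem_Iio]
    refine ⟨fun hx i hi => by simpa [hi] using hx ⟨i, hi⟩, fun hx i => by simpa using hx i i.2⟩
  rw [h, measureReal_def, lam, Measure.infinitePi_pi _ fun i _ => MeasurableSet.of_discrete]
  rw [Finset.prod_congr rfl (g := fun _ => (2 : ENNReal)⁻¹)]
  · simp [ENNReal.toReal_pow]
  · intro i hi
    rw [dif_pos (Finset.mem_range.1 hi), PMF.toMeasure_apply_singleton _ _ (by simp)]
    simp

theorem disjoint_cyl {N : ℕ} {s t : Fin N → Bool} (h : s ≠ t) : Disjoint (cyl N s) (cyl N t) := by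
  rw [Set.disjoint_left]
  intro x hs ht
  exact h (funext fun i => (hs i).symm.trans (ht i))

theorem iUnion_cyl (N : ℕ) : ⋃ s, cyl N s = Set.univ :=
  Set.eq_univ_of_forall fun x => Set.mem_iUnion.2 ⟨fun i => x i, fun _ => rfl⟩

theorem lam_real_eq_sum {κ : Type*} (I : Finset κ) (Q : κ → Set Cantor)
    (hQ : ∀ i ∈ I, MeasurableSet (Q i)) (hd : (I : Set κ).PairwiseDisjoint Q)
    {A : Set Cantor} (hA : MeasurableSet A) (hcov : A ⊆ ⋃ i ∈ I, Q i) :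
    lam.real A = ∑ i ∈ I, lam.real (A ∩ Q i) := by
  rw [← measureReal_biUnion_finset]
  · congr 1
    ext x
    simp only [Set.mem_iUnion, Set.mem_inter_iff, exists_and_left, exists_prop]
    exact ⟨fun hx => ⟨hx, by simpa using hcov hx⟩, fun hx => hx.1⟩
  · exact fun i hi j hj hij => (hd hi hj hij).mono Set.inter_subset_right Set.inter_subset_right
  · exact fun i hi => hA.inter (hQ i hi)

/-- The signed imbalance of `A` in the coordinate `m`; `φ_m(A)` is its absolute value. -/
noncomputable def imb (m : ℕ) (A : Set Cantor) : ℝ :=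
  lam.real (A ∩ V m false) - lam.real (A ∩ V m true)

theorem phi_eq_abs_imb (m : ℕ) (A : Set Cantor) : phi m A = |imb m A| := rfl

theorem lam_real_V_add (m : ℕ) {A : Set Cantor} :
    lam.real (A ∩ V m false) + lam.real (A ∩ V m true) = lam.real A := by
  have h : A ∩ V m true = A \ V m false := by
    ext x
    simp [V]
  rw [h]
  exact measureReal_inter_add_sdiff (measurableSet_V m false)

theorem phi_le_lam (m : ℕ) (A : Set Cantor) : phi m A ≤ lam.real A := by
  have h := lam_real_V_add m (A := A)
  rw [phi, abs_le]
  constructor <;> linarith [measureReal_nonneg (μ := lam) (s := A ∩ V m false),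
    measureReal_nonneg (μ := lam) (s := A ∩ V m true)]

theorem imb_eq_sum {κ : Type*} (m : ℕ) (I : Finset κ) (Q : κ → Set Cantor)
    (hQ : ∀ i ∈ I, MeasurableSet (Q i)) (hd : (I : Set κ).PairwiseDisjoint Q)
    {A : Set Cantor} (hA : MeasurableSet A) (hcov : A ⊆ ⋃ i ∈ I, Q i) :
    imb m A = ∑ i ∈ I, imb m (A ∩ Q i) := by
  simp only [imb]
  rw [Finset.sum_sub_distrib,
    lam_real_eq_sum I Q hQ hd (hA.inter (measurableSet_V m false))
      (Set.inter_subset_left.trans hcov),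
    lam_real_eq_sum I Q hQ hd (hA.inter (measurableSet_V m true))
      (Set.inter_subset_left.trans hcov)]
  simp_rw [Set.inter_right_comm]

theorem imb_union (m : ℕ) {A B : Set Cantor} (hB : MeasurableSet B) (h : Disjoint A B) :
    imb m (A ∪ B) = imb m A + imb m B := by
  have key : ∀ i, lam.real ((A ∪ B) ∩ V m i) = lam.real (A ∩ V m i) + lam.real (B ∩ V m i) :=
    fun i => by
      rw [Set.union_inter_distrib_right]
      exact measureReal_union (h.mono Set.inter_subset_left Set.inter_subset_left)
        (hB.inter (measurableSet_V m i))
  rw [imb, key, key, imb, imb]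
  ring

theorem phi_union_le (m : ℕ) {A B : Set Cantor} (hB : MeasurableSet B) (h : Disjoint A B) :
    phi m (A ∪ B) ≤ phi m A + phi m B := by
  simp only [phi_eq_abs_imb]
  rw [imb_union m hB h]
  exact abs_add_le _ _

theorem phi_le_sum {κ : Type*} (m : ℕ) (I : Finset κ) (Q : κ → Set Cantor)
    (hQ : ∀ i ∈ I, MeasurableSet (Q i)) (hd : (I : Set κ).PairwiseDisjoint Q)
    {A : Set Cantor} (hA : MeasurableSet A) (hcov : A ⊆ ⋃ i ∈ I, Q i) :
    phi m A ≤ ∑ i ∈ I, phi m (A ∩ Q i) := by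
  rw [phi_eq_abs_imb, imb_eq_sum m I Q hQ hd hA hcov]
  exact Finset.abs_sum_le_sum_abs _ _

theorem abs_lam_real_sub_le {A B : Set Cantor} (hA : MeasurableSet A) (hB : MeasurableSet B) :
    |lam.real A - lam.real B| ≤ lam.real (symmDiff A B) := by
  have h1 := measureReal_inter_add_sdiff (μ := lam) (s := A) hB
  have h2 := measureReal_inter_add_sdiff (μ := lam) (s := B) hA
  rw [Set.inter_comm] at h2
  have h3 : lam.real (symmDiff A B) = lam.real (A \ B) + lam.real (B \ A) :=
    measureReal_union disjoint_sdiff_sdiff (hB.diff hA)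
  rw [h3, abs_le]
  constructor <;> linarith [measureReal_nonneg (μ := lam) (s := A \ B),
    measureReal_nonneg (μ := lam) (s := B \ A)]

theorem abs_imb_sub_le (m : ℕ) {A B : Set Cantor} (hA : MeasurableSet A) (hB : MeasurableSet B) :
    |imb m A - imb m B| ≤ lam.real (symmDiff A B) := by
  have h3 : ∀ i, |lam.real (A ∩ V m i) - lam.real (B ∩ V m i)| ≤
      lam.real (symmDiff A B ∩ V m i) := fun i => by
    rw [Set.inter_symmDiff_distrib_right]
    exact abs_lam_real_sub_le (hA.inter (measurableSet_V m i)) (hB.inter (measurableSet_V m i))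
  have := lam_real_V_add m (A := symmDiff A B)
  have h4 := abs_le.1 (h3 false)
  have h5 := abs_le.1 (h3 true)
  simp only [imb]
  rw [abs_le]
  constructor <;> linarith [h4.1, h4.2, h5.1, h5.2]

theorem lam_real_eq_sum_cyl (N : ℕ) {A : Set Cantor} (hA : MeasurableSet A) :
    lam.real A = ∑ s, lam.real (A ∩ cyl N s) :=
  lam_real_eq_sum Finset.univ (cyl N) (fun s _ => measurableSet_cyl N s)
    (fun _ _ _ _ h => disjoint_cyl h) hA (by simp [iUnion_cyl])

theorem imb_eq_sum_cyl (m N : ℕ) {A : Set Cantor} (hA : MeasurableSet A) :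
    imb m A = ∑ s, imb m (A ∩ cyl N s) :=
  imb_eq_sum m Finset.univ (cyl N) (fun s _ => measurableSet_cyl N s)
    (fun _ _ _ _ h => disjoint_cyl h) hA (by simp [iUnion_cyl])

theorem imb_inter_cyl {N : ℕ} (m : Fin N) (A : Set Cantor) (s : Fin N → Bool) :
    imb m (A ∩ cyl N s) = lam.real (A ∩ cyl N s) * sgn (s m) := by
  have h : ∀ i, A ∩ cyl N s ∩ V m i = if s m = i then A ∩ cyl N s else ∅ := by
    intro i
    ext x
    split_ifs with hi
    · simp only [Set.mem_inter_iff, and_iff_left_iff_imp]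
      exact fun hx => (hx.2 m).trans hi
    · simp only [Set.mem_inter_iff, Set.mem_empty_iff_false, iff_false, not_and]
      exact fun hx hV => hi ((hx.2 m).symm.trans hV)
  rw [imb, h, h]
  cases hs : s m <;> simp [sgn]

/-! ### Property (T) in terms of cylinders -/

theorem mem_iff_of_mem_cylAlg {n : ℕ} {W : Set Cantor} (hW : W ∈ cylAlg n) {x y : Cantor}
    (hxy : ∀ i ≤ n, x i = y i) : x ∈ W ↔ y ∈ W := by
  induction hW using BooleanSubalgebra.closure_bot_sup_induction with
  | mem W hW =>
    obtain ⟨m, hm, i, rfl⟩ := hW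
    simp [V, hxy m hm]
  | bot => simp
  | sup A _ B _ hA hB => exact or_congr hA hB
  | compl A _ hA => exact not_congr hA

theorem cyl_mem_cylAlg (n : ℕ) (s : Fin (n + 1) → Bool) : cyl (n + 1) s ∈ cylAlg n := by
  rw [cyl_eq_iInter]
  refine BooleanSubalgebra.iInf_mem fun i => BooleanSubalgebra.subset_closure ?_
  exact ⟨i, Nat.lt_succ_iff.1 i.2, s i, rfl⟩

theorem cyl_nonempty (N : ℕ) (s : Fin N → Bool) : (cyl N s).Nonempty :=
  ⟨fun i => if h : i < N then s ⟨i, h⟩ else false, fun i => by simp⟩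

theorem cyl_subset_of_mem_cylAlg {n : ℕ} {W : Set Cantor} (hW : W ∈ cylAlg n) {x : Cantor}
    (hx : x ∈ W) : cyl (n + 1) (fun i => x i) ⊆ W := by
  intro y hy
  refine (mem_iff_of_mem_cylAlg hW fun i hi => ?_).1 hx
  exact (hy ⟨i, Nat.lt_succ_iff.2 hi⟩).symm

theorem isAtom_cylAlg_iff {n : ℕ} (U : cylAlg n) :
    IsAtom U ↔ ∃ s, (U : Set Cantor) = cyl (n + 1) s := by
  constructor
  · intro hU
    have hne : (U : Set Cantor).Nonempty := by
      rw [Set.nonempty_iff_ne_empty]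
      exact fun h => hU.1 (Subtype.ext h)
    obtain ⟨x, hx⟩ := hne
    let C : cylAlg n := ⟨cyl (n + 1) (fun i => x i), cyl_mem_cylAlg n _⟩
    have hC : C ≤ U := cyl_subset_of_mem_cylAlg U.2 hx
    rcases hU.le_iff.1 hC with h | h
    · exfalso
      have := congrArg (Subtype.val) h
      exact (cyl_nonempty (n + 1) (fun i => x i)).ne_empty this
    · exact ⟨_, congrArg Subtype.val h.symm⟩
  · rintro ⟨s, hs⟩
    refine ⟨fun h => ?_, fun W hW => ?_⟩
    · rw [h] at hs
      exact (cyl_nonempty (n + 1) s).ne_empty hs.symm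
    · by_contra hne
      have hWne : (W : Set Cantor).Nonempty := by
        rw [Set.nonempty_iff_ne_empty]
        exact fun h => hne (Subtype.ext h)
      obtain ⟨x, hx⟩ := hWne
      have hxU : x ∈ (U : Set Cantor) := hW.le hx
      rw [hs] at hxU
      have : (fun i : Fin (n + 1) => x i) = s := funext fun i => hxU i
      have h1 := cyl_subset_of_mem_cylAlg W.2 hx
      rw [this, ← hs] at h1
      exact absurd (show U ≤ W from h1) (not_le_of_gt hW)

/-- The set `S` satisfies conditions (T.1) and (T.2) with constant `ε` at the level `n`; the atoms of
`𝒜_n` are written as the cylinders of length `n + 1`. -/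
def IsTame (n : ℕ) (ε : ℝ) (S : Set Cantor) : Prop :=
  ∀ s : Fin (n + 1) → Bool,
    (lam.real (S ∩ cyl (n + 1) s) ≤ ε * (1 / 2) ^ (n + 1) / n ∨
      lam.real (cyl (n + 1) s \ S) ≤ ε * (1 / 2) ^ (n + 1) / n) ∧
    ∀ m : ℕ, n < m → phi m (S ∩ cyl (n + 1) s) ≤ ε * (1 / 2) ^ (n + 1) / m

theorem forall_isAtom_iff {n : ℕ} {ε : ℝ} {F : Finset (Set Cantor)} :
    (∀ U : cylAlg n, IsAtom U → ∀ A ∈ F,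
      (lam.real (A ∩ U) ≤ ε * lam.real (U : Set Cantor) / n ∨
        lam.real ((U : Set Cantor) \ A) ≤ ε * lam.real (U : Set Cantor) / n) ∧
      ∀ m : ℕ, n < m → phi m (A ∩ U) ≤ ε * lam.real (U : Set Cantor) / m) ↔
      ∀ A ∈ F, IsTame n ε A := by
  constructor
  · intro h A hA s
    have := h ⟨cyl (n + 1) s, cyl_mem_cylAlg n s⟩ ((isAtom_cylAlg_iff _).2 ⟨s, rfl⟩) A hA
    simpa only [lam_real_cyl] using this
  · intro h U hU A hA
    obtain ⟨s, hs⟩ := (isAtom_cylAlg_iff U).1 hU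
    rw [hs, lam_real_cyl]
    exact h A hA s

theorem IsTame.mono {n : ℕ} {ε ε' : ℝ} {S : Set Cantor} (h : IsTame n ε S) (hε : ε ≤ ε') :
    IsTame n ε' S := by
  have h1 : ∀ m : ℕ, ε * (1 / 2) ^ (n + 1) / m ≤ ε' * (1 / 2) ^ (n + 1) / m := fun m => by gcongr
  exact fun s => ⟨(h s).1.imp (fun a => a.trans (h1 n)) (fun a => a.trans (h1 n)),
    fun m hm => ((h s).2 m hm).trans (h1 m)⟩

/-- The levels in property (T) can be taken arbitrarily large: a level `n < M` is excluded by the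
clopen sets `V_M^0` and `V_M^1`. -/
theorem PropertyT.exists_level {ℬ : BooleanSubalgebra (Set Cantor)} (hT : PropertyT ℬ)
    (F : Finset (Set Cantor)) (hF : ∀ A ∈ F, A ∈ ℬ) {ε : ℝ} (hε : 0 < ε) (M : ℕ) :
    ∃ n : ℕ, 0 < n ∧ M ≤ n ∧ ∀ A ∈ F, IsTame n ε A := by
  classical
  obtain ⟨n, hn, h⟩ := hT.approx (F ∪ {V M false, V M true})
    (by
      intro A hA
      simp only [Finset.mem_union, Finset.mem_insert, Finset.mem_singleton] at hA
      rcases hA with hA | rfl | rfl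
      · exact hF A hA
      · exact hT.clopen _ (isClopen_V _ _)
      · exact hT.clopen _ (isClopen_V _ _)) (min ε (1 / 4)) (by positivity)
  rw [forall_isAtom_iff] at h
  refine ⟨n, hn, ?_, fun A hA => (h A (Finset.mem_union_left _ hA)).mono (min_le_left _ _)⟩
  by_contra! hM
  let s : Fin (n + 1) → Bool := fun _ => false
  have key : ∀ i, V M i ∈ F ∪ {V M false, V M true} →
      lam.real (cyl (n + 1) s ∩ V M i) ≤ 1 / 4 * (1 / 2) ^ (n + 1) := by
    intro i hi
    have h1 := ((h _ hi s).2 M hM)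
    have h2 : phi M (V M i ∩ cyl (n + 1) s) = lam.real (cyl (n + 1) s ∩ V M i) := by
      have e1 : V M i ∩ cyl (n + 1) s ∩ V M i = cyl (n + 1) s ∩ V M i := by
        ext x; simp only [Set.mem_inter_iff]; tauto
      have e2 : ∀ j, j ≠ i → V M i ∩ cyl (n + 1) s ∩ V M j = ∅ := by
        intro j hj
        ext x
        simp only [Set.mem_inter_iff, Set.mem_empty_iff_false, iff_false, V, Set.mem_ofPred_eq]
        exact fun hx => hj (hx.2.symm.trans hx.1.1)
      cases i
      · rw [phi, e1, e2 true (by simp)]; simp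
      · rw [phi, e1, e2 false (by simp)]; simp
    rw [h2] at h1
    refine h1.trans ?_
    have hM1 : (1 : ℝ) ≤ M := by exact_mod_cast (hn.trans hM)
    calc min ε (1 / 4) * (1 / 2) ^ (n + 1) / M ≤ min ε (1 / 4) * (1 / 2) ^ (n + 1) :=
          div_le_self (by positivity) hM1
      _ ≤ _ := by gcongr; exact min_le_right _ _
  have h3 := lam_real_V_add M (A := cyl (n + 1) s)
  rw [lam_real_cyl] at h3
  have h4 : (0 : ℝ) < (1 / 2) ^ (n + 1) := by positivity
  linarith [key false (by simp), key true (by simp)]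

/-! ### Balanced modifications -/

open Classical in
/-- The words of length `N` that extend a word `u` of length `n`. -/
noncomputable def extensions {n : ℕ} (u : Fin n → Bool) (N : ℕ) : Finset (Fin N → Bool) :=
  Finset.univ.filter fun s => cyl N s ⊆ cyl n u

theorem mem_extensions {n N : ℕ} (h : n ≤ N) {u : Fin n → Bool} {s : Fin N → Bool} :
    s ∈ extensions u N ↔ ∀ i : Fin n, s (Fin.castLE h i) = u i := by
  simp only [extensions, Finset.mem_filter, Finset.mem_univ, true_and]
  constructor
  · intro hs i
    obtain ⟨x, hx⟩ := cyl_nonempty N s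
    exact (hx (Fin.castLE h i)).symm.trans (hs hx i)
  · intro hs x hx i
    exact (hx (Fin.castLE h i)).trans (hs i)

theorem flip_mem_extensions {n N : ℕ} (h : n ≤ N) {u : Fin n → Bool} {s : Fin N → Bool}
    (hs : s ∈ extensions u N) {k : Fin N} (hk : n ≤ k) : flip k s ∈ extensions u N := by
  rw [mem_extensions h] at hs ⊢
  intro i
  rw [flip_of_ne _ s, hs i]
  intro hik
  have := congrArg Fin.val hik
  simp only [Fin.val_castLE] at this
  omega

theorem cyl_inter_cyl_of_not_mem_extensions {n N : ℕ} (h : n ≤ N) {u : Fin n → Bool}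
    {s : Fin N → Bool} (hs : s ∉ extensions u N) : cyl n u ∩ cyl N s = ∅ := by
  rw [mem_extensions h] at hs
  push Not at hs
  obtain ⟨i, hi⟩ := hs
  ext x
  simp only [Set.mem_inter_iff, Set.mem_empty_iff_false, iff_false, not_and]
  exact fun hu hx => hi ((hx (Fin.castLE h i)).symm.trans (hu i))

theorem lam_real_inter_cyl_eq_sum {n N : ℕ} (h : n ≤ N) (u : Fin n → Bool) {A : Set Cantor}
    (hA : MeasurableSet A) :
    lam.real (A ∩ cyl n u) = ∑ s ∈ extensions u N, lam.real (A ∩ cyl N s) := by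
  rw [lam_real_eq_sum_cyl N (hA.inter (measurableSet_cyl n u)),
    ← Finset.sum_subset (Finset.subset_univ (extensions u N))]
  · refine Finset.sum_congr rfl fun s hs => ?_
    simp only [extensions, Finset.mem_filter] at hs
    rw [Set.inter_assoc, Set.inter_eq_self_of_subset_right hs.2]
  · intro s _ hs
    rw [Set.inter_assoc, cyl_inter_cyl_of_not_mem_extensions h hs]
    simp

theorem card_extensions {n N : ℕ} (h : n ≤ N) (u : Fin n → Bool) :
    ((extensions u N).card : ℝ) * (1 / 2) ^ N = (1 / 2) ^ n := by
  have := lam_real_inter_cyl_eq_sum h u MeasurableSet.univ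
  simp only [Set.univ_inter, lam_real_cyl, Finset.sum_const, nsmul_eq_mul] at this
  exact this.symm

theorem half_pow_mul_two_pow (N : ℕ) : (1 / 2 : ℝ) ^ N * 2 ^ N = 1 := by
  rw [← mul_pow]
  norm_num

/-- Let `R` be almost all of a cylinder. At any finer level where `R` satisfies (T.1), a small set `W`
can be balanced by few cylinders that are almost contained in `R`. -/
theorem exists_balancing_cyls {n N : ℕ} (hnN : n ≤ N) (hN : 0 < N) {R W : Set Cantor}
    (hR : MeasurableSet R) (hW : MeasurableSet W) {ε δ : ℝ} (hε2 : ε ≤ 1 / 2)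
    (hRT : IsTame N ε R) (u : Fin (n + 1) → Bool)
    (hu : lam.real (cyl (n + 1) u \ R) ≤ 1 / 100 * (1 / 2) ^ (n + 1))
    (hδ : 0 ≤ δ) (hδ1 : δ ≤ 1) (hWδ : 64 * lam.real W ≤ (δ * (1 / 2) ^ (n + 1)) ^ 2) :
    ∃ S : Finset (Fin (N + 1) → Bool), (S.card : ℝ) * (1 / 2) ^ (N + 1) ≤ δ ∧
      (∀ s ∈ S, lam.real (cyl (N + 1) s \ R) ≤ ε * (1 / 2) ^ (N + 1) / N) ∧
      ∀ m : Fin (N + 1), n < m →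
        |imb m W + ∑ s ∈ S, imb m (cyl (N + 1) s)| ≤ (N + 2) * (1 / 2) ^ (N + 1) := by
  classical
  have hnN' : n + 1 ≤ N + 1 := by omega
  set p : ℝ := (1 / 2) ^ (N + 1) with hp
  have hp0 : 0 < p := by positivity
  have hpp : p * 2 ^ (N + 1) = 1 := half_pow_mul_two_pow _
  set U := extensions u (N + 1)
  set G := U.filter fun s => lam.real (cyl (N + 1) s \ R) ≤ ε * p / N with hGdef
  have hUcard : (U.card : ℝ) * p = (1 / 2) ^ (n + 1) := card_extensions hnN' u
  have hN1 : (1 : ℝ) ≤ N := by exact_mod_cast hN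
  -- by (T.1), `R` is almost disjoint from the cylinders of `U \ G`
  have hbad : ∀ s ∈ U \ G, p / 2 ≤ lam.real (cyl (N + 1) s \ R) := by
    intro s hs
    obtain ⟨hsU, hsG⟩ := Finset.mem_sdiff.1 hs
    have h1 : lam.real (R ∩ cyl (N + 1) s) ≤ ε * p / N :=
      (hRT s).1.resolve_right fun h => hsG (Finset.mem_filter.2 ⟨hsU, h⟩)
    have h2 : ε * p / N ≤ p / 2 := by
      rw [div_le_iff₀ (by linarith)]
      nlinarith
    have h3 := measureReal_inter_add_sdiff (μ := lam) (s := cyl (N + 1) s) hR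
    rw [lam_real_cyl, Set.inter_comm, ← hp] at h3
    linarith
  have hG : 50 * ((U \ G).card : ℝ) ≤ U.card := by
    have h1 : ((U \ G).card : ℝ) * (p / 2) ≤ 1 / 100 * (1 / 2) ^ (n + 1) := by
      calc ((U \ G).card : ℝ) * (p / 2) = ∑ s ∈ U \ G, p / 2 := by simp
        _ ≤ ∑ s ∈ U \ G, lam.real (cyl (N + 1) s \ R) := Finset.sum_le_sum hbad
        _ ≤ ∑ s ∈ U, lam.real (cyl (N + 1) s \ R) :=
            Finset.sum_le_sum_of_subset_of_nonneg Finset.sdiff_subset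
              fun _ _ _ => measureReal_nonneg
        _ = lam.real (cyl (n + 1) u \ R) := by
            have := lam_real_inter_cyl_eq_sum hnN' u hR.compl
            rw [Set.inter_comm, ← Set.sdiff_eq] at this
            rw [this]
            refine Finset.sum_congr rfl fun s _ => ?_
            rw [Set.inter_comm, ← Set.sdiff_eq]
        _ ≤ _ := hu
    rw [← hUcard] at h1
    nlinarith
  obtain ⟨S, hSG, hScard, hS⟩ := exists_balancing_finset (U := U) (G := G)
    (M := Finset.univ.filter fun k : Fin (N + 1) => n < k)
    (y := fun s => lam.real (W ∩ cyl (N + 1) s) * 2 ^ (N + 1)) (δ := δ)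
    (fun k hk s hs => flip_mem_extensions hnN' hs (Finset.mem_filter.1 hk).2)
    (Finset.filter_subset _ _) hG
    (fun s => ⟨by positivity, by
      rw [← hpp]
      refine mul_le_mul_of_nonneg_right ?_ (by positivity)
      rw [hp, ← lam_real_cyl (N + 1) s]
      exact measureReal_mono Set.inter_subset_right⟩) hδ hδ1 (by
      rw [← Finset.sum_mul, ← lam_real_eq_sum_cyl (N + 1) hW, Fintype.card_fin]
      have : (U.card : ℝ) = (1 / 2) ^ (n + 1) * 2 ^ (N + 1) := by
        rw [← hUcard, mul_assoc, hpp, mul_one]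
      rw [this]
      have h0 : (0 : ℝ) ≤ (2 ^ (N + 1)) ^ 2 := by positivity
      have := mul_le_mul_of_nonneg_right hWδ h0
      linarith)
  refine ⟨S, ?_, fun s hs => (Finset.mem_filter.1 (hSG hs)).2, fun m hm => ?_⟩
  · have h1 : (G.card : ℝ) ≤ 2 ^ (N + 1) := by
      have := Finset.card_le_univ G
      rw [Fintype.card_fun, Fintype.card_bool, Fintype.card_fin] at this
      exact_mod_cast this
    calc (S.card : ℝ) * p ≤ δ * 2 ^ (N + 1) * p := by
          refine mul_le_mul_of_nonneg_right (hScard.trans ?_) hp0.le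
          exact mul_le_mul_of_nonneg_left h1 hδ
      _ = δ := by rw [mul_assoc, mul_comm _ p, hpp, mul_one]
  · have h1 := hS m (Finset.mem_filter.2 ⟨Finset.mem_univ _, hm⟩)
    have h2 : imb m W + ∑ s ∈ S, imb m (cyl (N + 1) s) =
        (∑ s, lam.real (W ∩ cyl (N + 1) s) * 2 ^ (N + 1) * sgn (s m) + ∑ s ∈ S, sgn (s m)) * p := by
      rw [imb_eq_sum_cyl m (N + 1) hW, add_mul, Finset.sum_mul, Finset.sum_mul]
      congr 1
      · refine Finset.sum_congr rfl fun s _ => ?_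
        rw [imb_inter_cyl]
        linear_combination (-lam.real (W ∩ cyl (N + 1) s) * sgn (s m)) * hpp
      · refine Finset.sum_congr rfl fun s _ => ?_
        have := imb_inter_cyl m Set.univ s
        rw [Set.univ_inter, lam_real_cyl] at this
        rw [this, mul_comm]
    rw [h2, abs_mul, abs_of_pos hp0]
    refine mul_le_mul_of_nonneg_right (h1.trans ?_) hp0.le
    have h3 := Finset.card_le_univ (Finset.univ.filter fun k : Fin (N + 1) => n < k)
    rw [Fintype.card_fin] at h3
    have h4 : ((Finset.univ.filter fun k : Fin (N + 1) => n < k).card : ℝ) ≤ N + 1 := by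
      exact_mod_cast h3
    linarith

/-- The modification for a given finite partition `Q` and a level `n` at which each relevant piece is
almost all of some cylinder. -/
theorem exists_modification_of_partition {ℬ 𝒞 : BooleanSubalgebra (Set Cantor)} (hT : PropertyT ℬ)
    (hle : 𝒞 ≤ ℬ) (hclopen : ∀ A : Set Cantor, IsClopen A → A ∈ 𝒞) {κ : Type*} [DecidableEq κ]
    (I J : Finset κ) (Q : κ → Set Cantor) (hQ : ∀ i ∈ I, Q i ∈ ℬ)
    (hd : (I : Set κ).PairwiseDisjoint Q) {K : Set Cantor} (hK : K ∈ 𝒞) (hJ : J ⊆ I)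
    (hJK : ∀ i ∈ J, Disjoint (Q i) K) (hIJ : ∀ i ∈ I, i ∉ J → lam.real (Q i \ K) = 0)
    (n : ℕ) (u : κ → Fin (n + 1) → Bool)
    (hu : ∀ i ∈ J, lam.real (cyl (n + 1) (u i) \ Q i) ≤ 1 / 200 * (1 / 2) ^ (n + 1))
    {δ η : ℝ} (hδ : 0 ≤ δ) (hδ1 : δ ≤ 1) (hη : 0 < η) {H Y : Set Cantor} (hH : H ∈ 𝒞) (hY : Y ∈ 𝒞)
    (hYH : Y ⊆ H) (hHK : Disjoint H K) (hH1 : lam.real H ≤ 1 / 200 * (1 / 2) ^ (n + 1))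
    (hH2 : 64 * lam.real H ≤ (δ * (1 / 2) ^ (n + 1)) ^ 2) :
    ∃ X ∈ 𝒞, X ∩ H = Y ∧ Disjoint X K ∧ lam.real X ≤ lam.real H + J.card * δ ∧
      ∀ i ∈ I, ∀ m, n < m → phi m (X ∩ Q i) ≤ η / m := by
  classical
  have mB : ∀ A ∈ ℬ, MeasurableSet A := hT.borel
  have mC : ∀ A ∈ 𝒞, MeasurableSet A := fun A hA => mB A (hle hA)
  -- the rounding error `(N + 2) 2⁻⁽ᴺ⁺¹⁾` of the balancing has to be negligible against `1 / N`
  obtain ⟨M, hM⟩ : ∃ M : ℕ, ∀ N ≥ M, ((N : ℝ) + 2) * (1 / 2) ^ (N + 1) * N ≤ η / 2 := by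
    have h2 := tendsto_pow_const_mul_const_pow_of_abs_lt_one 2 (r := (1 / 2 : ℝ))
      (by rw [abs_of_pos] <;> norm_num)
    have h1 := tendsto_pow_const_mul_const_pow_of_abs_lt_one 1 (r := (1 / 2 : ℝ))
      (by rw [abs_of_pos] <;> norm_num)
    have h := ((h2.const_mul (1 / 2)).add h1).eventually_le_const
      (show 1 / 2 * 0 + 0 < η / 2 by linarith)
    obtain ⟨M, hM⟩ := Filter.eventually_atTop.1 h
    refine ⟨M, fun N hN => ?_⟩
    have := hM N hN
    rw [pow_succ]
    linarith
  set ε : ℝ := min (1 / 2) (η / (2 * (J.card + 1))) with hε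
  have hε0 : 0 < ε := by positivity
  have hε1 : ε ≤ 1 / 2 := min_le_left _ _
  have hε2 : (J.card + 1) * ε ≤ η / 2 := by
    calc (J.card + 1) * ε ≤ (J.card + 1) * (η / (2 * (J.card + 1))) := by
          gcongr; exact min_le_right _ _
      _ = η / 2 := by field_simp
  obtain ⟨N, hN0, hNM, hN⟩ := hT.exists_level
    (I.image (fun i => Y ∩ Q i) ∪ I.image (fun i => Q i \ H))
    (by
      intro A hA
      rcases Finset.mem_union.1 hA with hA | hA <;> obtain ⟨i, hi, rfl⟩ := Finset.mem_image.1 hA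
      · exact ℬ.inf_mem (hle hY) (hQ i hi)
      · exact ℬ.sdiff_mem (hQ i hi) (hle hH)) hε0 (max M n)
  have hN1 : ∀ i ∈ I, IsTame N ε (Y ∩ Q i) := fun i hi =>
    hN _ (Finset.mem_union_left _ (Finset.mem_image_of_mem _ hi))
  have hN2 : ∀ i ∈ I, IsTame N ε (Q i \ H) := fun i hi =>
    hN _ (Finset.mem_union_right _ (Finset.mem_image_of_mem _ hi))
  have hnN : n ≤ N := (le_max_right _ _).trans hNM
  have hMN := hM N ((le_max_left _ _).trans hNM)
  have hNpos : (0 : ℝ) < N := by exact_mod_cast hN0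
  set p : ℝ := (1 / 2) ^ (N + 1) with hp
  have hp0 : 0 < p := by positivity
  have hex : ∀ i : κ, ∃ S : Finset (Fin (N + 1) → Bool), i ∈ J →
      ((S.card : ℝ) * p ≤ δ ∧
      (∀ s ∈ S, lam.real (cyl (N + 1) s \ (Q i \ H)) ≤ ε * p / N) ∧
      ∀ m : Fin (N + 1), n < m →
        |imb m (Y ∩ Q i) + ∑ s ∈ S, imb m (cyl (N + 1) s)| ≤ (N + 2) * p) := by
    intro i
    by_cases hi : i ∈ J
    · obtain ⟨S, hS⟩ := exists_balancing_cyls hnN hN0 ((mB _ (hQ i (hJ hi))).diff (mC H hH))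
        ((mC Y hY).inter (mB _ (hQ i (hJ hi)))) hε1 (hN2 i (hJ hi)) (u i)
        (by
          have h1 : cyl (n + 1) (u i) \ (Q i \ H) ⊆ (cyl (n + 1) (u i) \ Q i) ∪ H := by
            intro x hx
            simp only [Set.mem_sdiff, Set.mem_union] at hx ⊢
            tauto
          have h2 := (measureReal_mono (μ := lam) h1).trans (measureReal_union_le _ _)
          linarith [hu i hi]) hδ hδ1
        (by
          have : lam.real (Y ∩ Q i) ≤ lam.real H :=
            measureReal_mono (Set.inter_subset_left.trans hYH)
          linarith)
      exact ⟨S, fun _ => hS⟩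
    · exact ⟨∅, fun h => absurd h hi⟩
  choose S hS using hex
  let D : κ → Set Cantor := fun i => ⋃ s ∈ S i, cyl (N + 1) s
  have hDclopen : ∀ i, IsClopen (D i) := fun i =>
    (S i).finite_toSet.isClopen_biUnion fun s _ => isClopen_cyl _ s
  let C : Set Cantor := ⋃ i ∈ J, D i
  have hCclopen : IsClopen C := J.finite_toSet.isClopen_biUnion fun i _ => hDclopen i
  have hCm : MeasurableSet C := hCclopen.isOpen.measurableSet
  -- `C` does not split cylinders of level `N`, so it creates no imbalance beyond `N`
  have hCcyl : ∀ s, cyl (N + 1) s ⊆ C ∨ C ∩ cyl (N + 1) s = ∅ := by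
    intro s
    by_cases h : ∃ i ∈ J, s ∈ S i
    · obtain ⟨i, hi, hs⟩ := h
      exact Or.inl ((Set.subset_biUnion_of_mem (u := fun s => cyl (N + 1) s) hs).trans
        (Set.subset_biUnion_of_mem (u := fun i => D i) hi))
    · push Not at h
      right
      ext x
      simp only [C, D, Set.mem_inter_iff, Set.mem_iUnion, Set.mem_empty_iff_false, iff_false]
      rintro ⟨⟨i, hi, t, ht, hx⟩, hxs⟩
      have : t ≠ s := fun e => h i hi (e ▸ ht)
      exact Set.disjoint_left.1 (disjoint_cyl this) hx hxs
  have hClam : lam.real C ≤ J.card * δ := by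
    calc lam.real C ≤ ∑ i ∈ J, lam.real (D i) := measureReal_biUnion_finset_le _ _
      _ ≤ ∑ i ∈ J, δ := by
        refine Finset.sum_le_sum fun i hi => ?_
        calc lam.real (D i) ≤ ∑ s ∈ S i, lam.real (cyl (N + 1) s) :=
              measureReal_biUnion_finset_le _ _
          _ = (S i).card * p := by simp [lam_real_cyl, hp]
          _ ≤ δ := (hS i hi).1
      _ = J.card * δ := by simp
  refine ⟨Y ∪ (C \ (H ∪ K)), ?_, ?_, ?_, ?_, ?_⟩
  · exact 𝒞.sup_mem hY (𝒞.sdiff_mem (hclopen C hCclopen) (𝒞.sup_mem hH hK))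
  · ext x
    have := @hYH x
    simp only [Set.mem_inter_iff, Set.mem_union, Set.mem_sdiff]
    tauto
  · rw [Set.disjoint_left] at hHK ⊢
    intro x
    have h1 := @hYH x
    have h2 := @hHK x
    simp only [Set.mem_union, Set.mem_sdiff]
    tauto
  · refine (measureReal_union_le _ _).trans (add_le_add (measureReal_mono hYH) ?_)
    exact (measureReal_mono Set.sdiff_subset (measure_ne_top _ _)).trans hClam
  intro i hi m hm
  have hm0 : (0 : ℝ) < m := by exact_mod_cast (Nat.zero_le n).trans_lt hm
  by_cases hiJ : i ∉ J
  · have h1 : lam.real ((Y ∪ C \ (H ∪ K)) ∩ Q i) ≤ lam.real (Q i \ K) := by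
      refine measureReal_mono ?_
      intro x
      have h1 := @hYH x
      have h2 : x ∈ H → x ∉ K := fun h => Set.disjoint_left.1 hHK h
      simp only [Set.mem_inter_iff, Set.mem_union, Set.mem_sdiff]
      tauto
    rw [hIJ i hi hiJ] at h1
    exact (phi_le_lam _ _).trans (h1.trans (by positivity))
  rw [not_not] at hiJ
  obtain ⟨hS1, hS2, hS3⟩ := hS i hiJ
  have hsplit : (Y ∪ C \ (H ∪ K)) ∩ Q i = (Y ∩ Q i) ∪ (C ∩ (Q i \ H)) := by
    ext x
    have h2 : x ∈ Q i → x ∉ K := fun h => Set.disjoint_left.1 (hJK i hiJ) h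
    simp only [Set.mem_inter_iff, Set.mem_union, Set.mem_sdiff]
    tauto
  have hdisj : Disjoint (Y ∩ Q i) (C ∩ (Q i \ H)) := by
    rw [Set.disjoint_left]
    intro x hx hx'
    exact hx'.2.2 (hYH hx.1)
  have hmR : MeasurableSet (Q i \ H) := (mB _ (hQ i hi)).diff (mC H hH)
  have hmW : MeasurableSet (Y ∩ Q i) := (mC Y hY).inter (mB _ (hQ i hi))
  rw [hsplit]
  rcases le_or_gt m N with hmN | hmN
  · have h1 := hS3 ⟨m, Nat.lt_succ_of_le hmN⟩ hm
    simp only at h1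
    have hD : imb m (D i) = ∑ s ∈ S i, imb m (cyl (N + 1) s) := by
      rw [imb_eq_sum m (S i) (cyl (N + 1)) (fun s _ => measurableSet_cyl _ s)
        (fun _ _ _ _ h => disjoint_cyl h) (hDclopen i).isOpen.measurableSet subset_rfl]
      refine Finset.sum_congr rfl fun s hs => ?_
      have hsD : cyl (N + 1) s ⊆ D i :=
        Set.subset_biUnion_of_mem (u := fun s => cyl (N + 1) s) hs
      rw [Set.inter_eq_self_of_subset_right hsD]
    -- the cylinders chosen for `Q j` are almost contained in `Q j \ H`, hence almost miss `Q i`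
    have h2 : lam.real (symmDiff (C ∩ (Q i \ H)) (D i)) ≤ J.card * (ε / N) := by
      have hsub : symmDiff (C ∩ (Q i \ H)) (D i) ⊆
          ⋃ j ∈ J, ⋃ s ∈ S j, cyl (N + 1) s \ (Q j \ H) := by
        rintro x (⟨⟨hxC, hxR⟩, hxD⟩ | ⟨hxD, hxCR⟩)
        · simp only [C, D, Set.mem_iUnion] at hxC hxD ⊢
          obtain ⟨j, hj, s, hs, hxs⟩ := hxC
          refine ⟨j, hj, s, hs, hxs, fun hxj => hxD ?_⟩
          have hij : j = i := by
            by_contra hne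
            exact Set.disjoint_left.1 (hd (hJ hj) hi hne) hxj.1 hxR.1
          subst hij
          exact ⟨s, hs, hxs⟩
        · have hxC : x ∈ C := Set.mem_biUnion hiJ hxD
          have hxR : x ∉ Q i \ H := fun h => hxCR ⟨hxC, h⟩
          simp only [D, Set.mem_iUnion] at hxD ⊢
          obtain ⟨s, hs, hxs⟩ := hxD
          exact ⟨i, hiJ, s, hs, hxs, hxR⟩
      refine (measureReal_mono hsub (measure_ne_top _ _)).trans ((measureReal_biUnion_finset_le _ _).trans ?_)
      calc ∑ j ∈ J, lam.real (⋃ s ∈ S j, cyl (N + 1) s \ (Q j \ H)) ≤ ∑ j ∈ J, ε / N := by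
            refine Finset.sum_le_sum fun j hj => (measureReal_biUnion_finset_le _ _).trans ?_
            refine (Finset.sum_le_sum fun s hs => (hS j hj).2.1 s hs).trans ?_
            rw [Finset.sum_const, nsmul_eq_mul]
            have h3 := (hS j hj).1
            calc ((S j).card : ℝ) * (ε * p / N) = ((S j).card * p) * (ε / N) := by ring
              _ ≤ 1 * (ε / N) := by gcongr; exact h3.trans hδ1
              _ = ε / N := one_mul _
        _ = J.card * (ε / N) := by simp
    have h3 := abs_imb_sub_le m (hCm.inter hmR) (hDclopen i).isOpen.measurableSet
    rw [phi_eq_abs_imb, imb_union m (hCm.inter hmR) hdisj]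
    rw [← hD] at h1
    have h4 : |imb m (Y ∩ Q i) + imb m (C ∩ (Q i \ H))| ≤ (N + 2) * p + J.card * (ε / N) := by
      have h5 := abs_le.1 h1
      have h6 := abs_le.1 (h3.trans h2)
      rw [abs_le]
      constructor <;> linarith [h5.1, h5.2, h6.1, h6.2]
    have h7 : (N + 2) * p + J.card * (ε / N) ≤ η / N := by
      rw [le_div_iff₀ hNpos]
      have : ((N + 2) * p + J.card * (ε / N)) * N = (N + 2) * p * N + J.card * ε := by
        field_simp
      rw [this]
      linarith
    refine h4.trans (h7.trans ?_)
    gcongr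
  · have hmA : MeasurableSet ((Y ∩ Q i) ∪ (C ∩ (Q i \ H))) := hmW.union (hCm.inter hmR)
    have key : ∀ s, phi m (((Y ∩ Q i) ∪ (C ∩ (Q i \ H))) ∩ cyl (N + 1) s) ≤ η * p / m := by
      intro s
      rw [Set.union_inter_distrib_right]
      refine (phi_union_le m ((hCm.inter hmR).inter (measurableSet_cyl _ s))
        (hdisj.mono Set.inter_subset_left Set.inter_subset_left)).trans ?_
      have h1 := (hN1 i hi s).2 m hmN
      have h2 := (hN2 i hi s).2 m hmN
      have h0 : 0 ≤ ε * p / m := by positivity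
      have h3 : phi m (C ∩ (Q i \ H) ∩ cyl (N + 1) s) ≤ ε * p / m := by
        rcases hCcyl s with h | h
        · have : C ∩ (Q i \ H) ∩ cyl (N + 1) s = (Q i \ H) ∩ cyl (N + 1) s := by
            rw [Set.inter_assoc]
            exact Set.inter_eq_self_of_subset_right (Set.inter_subset_right.trans h)
          rw [this]
          exact h2
        · have : C ∩ (Q i \ H) ∩ cyl (N + 1) s = ∅ := by
            rw [Set.inter_right_comm, h, Set.empty_inter]
          rw [this]
          simpa [phi] using h0
      have h4 : ε ≤ η / 2 := by
        have : (0 : ℝ) ≤ J.card * ε := by positivity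
        linarith
      calc _ ≤ ε * p / m + ε * p / m := add_le_add h1 h3
        _ ≤ η / 2 * p / m + η / 2 * p / m := by gcongr
        _ = η * p / m := by ring
    rw [phi_eq_abs_imb, imb_eq_sum_cyl m (N + 1) hmA]
    refine (Finset.abs_sum_le_sum_abs _ _).trans ((Finset.sum_le_sum fun s _ => key s).trans ?_)
    rw [Finset.sum_const, nsmul_eq_mul, Finset.card_univ, Fintype.card_fun, Fintype.card_bool,
      Fintype.card_fin]
    push_cast
    have := half_pow_mul_two_pow (N + 1)
    rw [← hp] at this
    apply le_of_eq
    linear_combination (η / m) * this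

open Classical in
/-- The atom of the finite algebra generated by `F` that lies in the members of `t` and in no other
member of `F`; it is empty unless `t ⊆ F`. -/
def atomOf (F t : Finset (Set Cantor)) : Set Cantor := {x | F.filter (x ∈ ·) = t}

theorem mem_iff_of_mem_atomOf {F t : Finset (Set Cantor)} {x : Cantor} (hx : x ∈ atomOf F t)
    {A : Set Cantor} (hA : A ∈ F) : x ∈ A ↔ A ∈ t := by
  obtain rfl : _ = t := hx
  simp [hA]

theorem atomOf_mem {ℬ : BooleanSubalgebra (Set Cantor)} {F t : Finset (Set Cantor)}
    (hF : ∀ A ∈ F, A ∈ ℬ) (ht : t ⊆ F) : atomOf F t ∈ ℬ := by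
  classical
  have : atomOf F t = ⋂ A ∈ F, if A ∈ t then A else Aᶜ := by
    ext x
    simp only [Set.mem_iInter]
    constructor
    · intro hx A hA
      have := mem_iff_of_mem_atomOf hx hA
      split_ifs with h
      · exact this.2 h
      · exact fun hxA => h (this.1 hxA)
    · intro hx
      change F.filter (x ∈ ·) = t
      ext A
      rw [Finset.mem_filter]
      constructor
      · rintro ⟨hA, hxA⟩
        by_contra h
        have := hx A hA
        rw [if_neg h] at this
        exact this hxA
      · intro h
        have := hx A (ht h)
        rw [if_pos h] at this
        exact ⟨ht h, this⟩
  rw [this]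
  refine BooleanSubalgebra.biInf_mem F.finite_toSet fun A hA => ?_
  split_ifs
  exacts [hF A hA, ℬ.compl_mem (hF A hA)]

theorem disjoint_atomOf {F t t' : Finset (Set Cantor)} (h : t ≠ t') :
    Disjoint (atomOf F t) (atomOf F t') :=
  Set.disjoint_left.2 fun _ (hx : _ = t) (hx' : _ = t') => h (hx.symm.trans hx')

theorem biUnion_atomOf (F : Finset (Set Cantor)) : ⋃ t ∈ F.powerset, atomOf F t = Set.univ := by
  classical
  exact Set.eq_univ_of_forall fun x =>
    Set.mem_biUnion (Finset.mem_powerset.2 (Finset.filter_subset (x ∈ ·) F)) rfl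

/-- A small piece `H` can be modified arbitrarily, at the price of a small balanced modification
outside `H` and `K`: there is a small `X` with prescribed trace `Y` on `H` whose intersections with the
members of a finite family have small imbalances in all coordinates at once. -/
theorem exists_balanced_modification {ℬ 𝒞 : BooleanSubalgebra (Set Cantor)} (hT : PropertyT ℬ)
    (hle : 𝒞 ≤ ℬ) (hclopen : ∀ A : Set Cantor, IsClopen A → A ∈ 𝒞) (F : Finset (Set Cantor))
    (hF : ∀ A ∈ F, A ∈ ℬ) {K : Set Cantor} (hK : K ∈ 𝒞) {η : ℝ} (hη : 0 < η) :
    ∃ α > 0, ∀ H ∈ 𝒞, ∀ Y ∈ 𝒞, Y ⊆ H → Disjoint H K → lam.real H ≤ α →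
      ∃ X ∈ 𝒞, X ∩ H = Y ∧ Disjoint X K ∧ lam.real X ≤ η ∧
        ∀ A ∈ F, ∀ m : ℕ, 0 < m → phi m (X ∩ A) ≤ η / m := by
  classical
  have mB : ∀ A ∈ ℬ, MeasurableSet A := hT.borel
  set F' := insert K F with hF'
  have hF'B : ∀ A ∈ F', A ∈ ℬ := by
    intro A hA
    rcases Finset.mem_insert.1 hA with rfl | hA
    exacts [hle hK, hF A hA]
  let Q := fun t => atomOf F' t
  let I := F'.powerset
  have hQmem : ∀ t, ∀ x ∈ Q t, ∀ A ∈ F', x ∈ A ↔ A ∈ t := fun t x hx A hA =>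
    mem_iff_of_mem_atomOf hx hA
  have hQ : ∀ t ∈ I, Q t ∈ ℬ := fun t ht => atomOf_mem hF'B (Finset.mem_powerset.1 ht)
  have hd : (I : Set (Finset (Set Cantor))).PairwiseDisjoint Q :=
    fun t _ t' _ hne => disjoint_atomOf hne
  have hcov : ⋃ t ∈ I, Q t = Set.univ := biUnion_atomOf F'
  let J := I.filter fun t => K ∉ t ∧ 0 < lam.real (Q t)
  have hKF' : K ∈ F' := Finset.mem_insert_self _ _
  have hJK : ∀ t ∈ J, Disjoint (Q t) K := fun t ht => Set.disjoint_left.2 fun x hx hxK =>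
    (Finset.mem_filter.1 ht).2.1 ((hQmem t x hx K hKF').1 hxK)
  have hIJ : ∀ t ∈ I, t ∉ J → lam.real (Q t \ K) = 0 := by
    intro t ht htJ
    by_cases hKt : K ∈ t
    · have : Q t \ K = ∅ := Set.sdiff_eq_empty.2 fun x hx => (hQmem t x hx K hKF').2 hKt
      simp [this]
    · have h0 : ¬ 0 < lam.real (Q t) := fun h => htJ (Finset.mem_filter.2 ⟨ht, hKt, h⟩)
      refine le_antisymm ((measureReal_mono Set.sdiff_subset).trans (not_lt.1 h0))
        measureReal_nonneg
  obtain ⟨ε, hε, hε0⟩ : ∃ ε : ℝ, (ε < 1 / 200 ∧ ∀ t ∈ J, ε < lam.real (Q t)) ∧ 0 < ε := by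
    have h1 : ∀ᶠ ε : ℝ in nhdsWithin 0 (Set.Ioi 0), ε < 1 / 200 :=
      (eventually_lt_nhds (by norm_num)).filter_mono nhdsWithin_le_nhds
    have h2 : ∀ᶠ ε : ℝ in nhdsWithin 0 (Set.Ioi 0), ∀ t ∈ J, ε < lam.real (Q t) :=
      (Filter.eventually_all_finset J).2 fun t ht =>
        (eventually_lt_nhds (Finset.mem_filter.1 ht).2.2).filter_mono nhdsWithin_le_nhds
    exact ((h1.and h2).and self_mem_nhdsWithin).exists
  -- at this level each `Q t` of positive measure fills some cylinder almost completely
  obtain ⟨n, hn0, -, hn⟩ := hT.exists_level (J.image Q) (by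
    intro A hA
    obtain ⟨t, ht, rfl⟩ := Finset.mem_image.1 hA
    exact hQ t (Finset.mem_filter.1 ht).1) hε0 0
  have hn1 : (1 : ℝ) ≤ n := by exact_mod_cast hn0
  set p : ℝ := (1 / 2) ^ (n + 1) with hp
  have hp0 : 0 < p := by positivity
  have hex : ∀ t, ∃ u : Fin (n + 1) → Bool,
      t ∈ J → lam.real (cyl (n + 1) u \ Q t) ≤ 1 / 200 * p := by
    intro t
    by_cases ht : t ∈ J
    · have hle' : ε * p / n ≤ ε * p := div_le_self (by positivity) hn1
      by_contra! hcon
      have hall : ∀ s, lam.real (Q t ∩ cyl (n + 1) s) ≤ ε * p := by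
        intro s
        refine ((hn _ (Finset.mem_image_of_mem Q ht) s).1.resolve_right fun h => ?_).trans hle'
        have h1 := (hcon s).2
        have h2 : ε * p ≤ 1 / 200 * p := by gcongr; exact hε.1.le
        linarith
      have hsum := lam_real_eq_sum_cyl (n + 1) (mB _ (hQ t (Finset.mem_filter.1 ht).1))
      have h2 := Finset.sum_le_sum fun s (_ : s ∈ Finset.univ) => hall s
      rw [← hsum, Finset.sum_const, nsmul_eq_mul, Finset.card_univ, Fintype.card_fun,
        Fintype.card_bool, Fintype.card_fin] at h2
      push_cast at h2
      have h3 := half_pow_mul_two_pow (n + 1)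
      rw [← hp] at h3
      have h4 : (2 : ℝ) ^ (n + 1) * (ε * p) = ε := by linear_combination ε * h3
      linarith [hε.2 t ht]
    · exact ⟨fun _ => false, fun h => absurd h ht⟩
  choose u hu using hex
  set δ : ℝ := min 1 (η / (2 * n * (J.card + 1))) with hδ
  have hδ0 : 0 < δ := by positivity
  have hδJ : J.card * δ ≤ η / (2 * n) := by
    calc J.card * δ ≤ (J.card + 1) * (η / (2 * n * (J.card + 1))) := by
          gcongr
          · linarith
          · exact min_le_right _ _
      _ = η / (2 * n) := by field_simp
  refine ⟨min (1 / 200 * p) (min ((δ * p) ^ 2 / 64) (η / (2 * n))), by positivity, ?_⟩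
  intro H hH Y hY hYH hHK hHα
  have a1 := hHα.trans (min_le_left _ _)
  have a2 := hHα.trans ((min_le_right _ _).trans (min_le_left _ _))
  have a3 := hHα.trans ((min_le_right _ _).trans (min_le_right _ _))
  obtain ⟨X, hX, hXH, hXK, hXlam, hXphi⟩ := exists_modification_of_partition hT hle hclopen I J Q hQ
    hd hK (Finset.filter_subset _ _) hJK hIJ n u hu hδ0.le (min_le_left _ _)
    (show 0 < η / (I.card + 1) by positivity) hH hY hYH hHK a1 (by linarith)
  have hXn : lam.real X ≤ η / n := by
    have : η / n = η / (2 * n) + η / (2 * n) := by field_simp; norm_num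
    linarith
  refine ⟨X, hX, hXH, hXK, hXn.trans (div_le_self hη.le hn1), fun A hA m hm => ?_⟩
  have hm0 : (0 : ℝ) < m := by exact_mod_cast hm
  have hXm := mB X (hle hX)
  rcases le_or_gt m n with hmn | hmn
  · refine (phi_le_lam _ _).trans ((measureReal_mono Set.inter_subset_left).trans (hXn.trans ?_))
    gcongr
  · refine (phi_le_sum m I Q (fun t ht => mB _ (hQ t ht)) hd (hXm.inter (mB A (hF A hA)))
      (by rw [hcov]; exact Set.subset_univ _)).trans ?_
    calc ∑ t ∈ I, phi m (X ∩ A ∩ Q t) ≤ ∑ t ∈ I, η / (I.card + 1) / m := by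
          refine Finset.sum_le_sum fun t ht => ?_
          by_cases hAt : A ∈ t
          · have : X ∩ A ∩ Q t = X ∩ Q t := by
              ext x
              have := fun hx => (hQmem t x hx A (Finset.mem_insert_of_mem hA)).2 hAt
              simp only [Set.mem_inter_iff]
              tauto
            rw [this]
            exact hXphi t ht m hmn
          · have : X ∩ A ∩ Q t = ∅ := by
              ext x
              have := fun hx => mt (hQmem t x hx A (Finset.mem_insert_of_mem hA)).1 hAt
              simp only [Set.mem_inter_iff, Set.mem_empty_iff_false]
              tauto
            rw [this]
            simp only [phi, Set.empty_inter, measureReal_empty, sub_zero, abs_zero]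
            positivity
      _ = I.card * (η / (I.card + 1)) / m := by
          rw [Finset.sum_const, nsmul_eq_mul, mul_div_assoc]
      _ ≤ η / m := by
          gcongr
          rw [mul_div_assoc', div_le_iff₀ (by positivity)]
          nlinarith

/-! ### The forcing conditions -/

/-- The element `(A₁ ∩ D) ∪ (A₂ \ D)` of the algebra generated by `A₁`, `A₂` and `D`. -/
def mix (D : Set Cantor) (P : Set Cantor × Set Cantor) : Set Cantor := P.1 ∩ D ∪ P.2 \ D

theorem mix_mem {ℬ : BooleanSubalgebra (Set Cantor)} {D : Set Cantor} {P : Set Cantor × Set Cantor}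
    (hD : D ∈ ℬ) (h1 : P.1 ∈ ℬ) (h2 : P.2 ∈ ℬ) : mix D P ∈ ℬ :=
  ℬ.sup_mem (ℬ.inf_mem h1 hD) (ℬ.sdiff_mem h2 hD)

theorem measurableSet_mix {D : Set Cantor} {P : Set Cantor × Set Cantor} (hD : MeasurableSet D)
    (h1 : MeasurableSet P.1) (h2 : MeasurableSet P.2) : MeasurableSet (mix D P) :=
  (h1.inter hD).union (h2.diff hD)

theorem symmDiff_mix_subset (D D' : Set Cantor) (P : Set Cantor × Set Cantor) :
    symmDiff (mix D P) (mix D' P) ⊆ symmDiff D D' := by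
  intro x
  simp only [mix, Set.mem_symmDiff, Set.mem_union, Set.mem_inter_iff, Set.mem_sdiff]
  tauto

theorem lam_real_symmDiff_triangle (A B C : Set Cantor) :
    lam.real (symmDiff A C) ≤ lam.real (symmDiff A B) + lam.real (symmDiff B C) :=
  (measureReal_mono (symmDiff_triangle A B C) (measure_ne_top _ _)).trans (measureReal_union_le _ _)

/-- Tameness at a fixed level and with a fixed constant is a closed condition for the metric
`λ(A ∆ B)`. -/
theorem isTame_of_forall_exists {n : ℕ} {ε : ℝ} {S : Set Cantor} (hS : MeasurableSet S)
    (h : ∀ δ > 0, ∃ S', MeasurableSet S' ∧ lam.real (symmDiff S S') < δ ∧ IsTame n ε S') :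
    IsTame n ε S := by
  have key : ∀ (S' U : Set Cantor), symmDiff (S ∩ U) (S' ∩ U) ⊆ symmDiff S S' := by
    intro S' U x
    simp only [Set.mem_symmDiff, Set.mem_inter_iff]
    tauto
  have key' : ∀ (S' U : Set Cantor), symmDiff (U \ S) (U \ S') ⊆ symmDiff S S' := by
    intro S' U x
    simp only [Set.mem_symmDiff, Set.mem_sdiff]
    tauto
  intro s
  have hU := measurableSet_cyl (n + 1) s
  set x := ε * (1 / 2) ^ (n + 1) / n
  constructor
  · by_contra! hcon
    obtain ⟨S', hS', hd, hT⟩ := h (min (lam.real (S ∩ cyl (n + 1) s) - x)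
      (lam.real (cyl (n + 1) s \ S) - x)) (lt_min (by linarith) (by linarith))
    have d1 := hd.trans_le (min_le_left _ _)
    have d2 := hd.trans_le (min_le_right _ _)
    have e1 := (abs_lam_real_sub_le (hS.inter hU) (hS'.inter hU)).trans
      (measureReal_mono (key S' _) (measure_ne_top _ _))
    have e2 := (abs_lam_real_sub_le (hU.diff hS) (hU.diff hS')).trans
      (measureReal_mono (key' S' _) (measure_ne_top _ _))
    rcases (hT s).1 with h1 | h1
    · linarith [(abs_le.1 e1).2]
    · linarith [(abs_le.1 e2).2]
  · intro m hm
    refine le_of_forall_pos_le_add fun δ hδ => ?_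
    obtain ⟨S', hS', hd, hT⟩ := h δ hδ
    have e1 := (abs_imb_sub_le m (hS.inter hU) (hS'.inter hU)).trans
      (measureReal_mono (key S' _) (measure_ne_top _ _))
    have e2 := (hT s).2 m hm
    rw [phi_eq_abs_imb] at e2 ⊢
    have e3 := abs_sub_abs_le_abs_sub (imb m (S ∩ cyl (n + 1) s)) (imb m (S' ∩ cyl (n + 1) s))
    linarith

/-- A promise restricts the future approximations `D` of the generic set: the sets `mix D P` for
`P ∈ F` have to be tame at the level `n` with a constant smaller than `ε`, and `D` has to remain
`ε`-close to `D₀`. -/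
structure Promise where
  n : ℕ
  ε : ℝ
  F : Finset (Set Cantor × Set Cantor)
  D₀ : Set Cantor

/-- The set `D` keeps the promise `π`. -/
def Promise.Holds (π : Promise) (D : Set Cantor) : Prop :=
  (∃ ε' < π.ε, ∀ P ∈ π.F, IsTame π.n ε' (mix D P)) ∧ lam.real (symmDiff D π.D₀) < π.ε

/-- Tameness of `mix D P` survives, with a larger constant, the change of `D` to `D ∆ X`, if `X` is small
and its intersections with the two sets on which `mix D P` gains and loses points are balanced. -/
theorem IsTame.symmDiff_mix {n : ℕ} (hn : 0 < n) {ε ε' η : ℝ} {D X : Set Cantor}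
    {P : Set Cantor × Set Cantor} (hD : MeasurableSet D) (hX : MeasurableSet X)
    (h1 : MeasurableSet P.1) (h2 : MeasurableSet P.2) (hT : IsTame n ε (mix D P))
    (hη0 : 0 ≤ η) (hη : 2 * η ≤ (ε' - ε) * (1 / 2) ^ (n + 1) / n) (hXη : lam.real X ≤ η)
    (hphi : ∀ s m, 0 < m →
      phi m (X ∩ ((symmDiff P.1 P.2 ∩ cyl (n + 1) s) \ mix D P)) ≤ η / m ∧
      phi m (X ∩ (symmDiff P.1 P.2 ∩ cyl (n + 1) s ∩ mix D P)) ≤ η / m) :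
    IsTame n ε' (mix (symmDiff D X) P) := by
  have hn1 : (1 : ℝ) ≤ n := by exact_mod_cast hn
  have mS := measurableSet_mix hD h1 h2
  have mS' : MeasurableSet (mix (symmDiff D X) P) := measurableSet_mix (hD.symmDiff hX) h1 h2
  have hsum : ∀ a : ℝ, ε * (1 / 2) ^ (n + 1) / a + (ε' - ε) * (1 / 2) ^ (n + 1) / a =
      ε' * (1 / 2) ^ (n + 1) / a := fun a => by ring
  intro s
  have hU := measurableSet_cyl (n + 1) s
  constructor
  · refine (hT s).1.imp (fun h => ?_) (fun h => ?_)
    · have : mix (symmDiff D X) P ∩ cyl (n + 1) s ⊆ mix D P ∩ cyl (n + 1) s ∪ X := by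
        intro x
        simp only [mix, Set.mem_symmDiff, Set.mem_union, Set.mem_inter_iff, Set.mem_sdiff]
        tauto
      have := (measureReal_mono this (measure_ne_top lam _)).trans (measureReal_union_le _ _)
      linarith [hsum n]
    · have : cyl (n + 1) s \ mix (symmDiff D X) P ⊆ cyl (n + 1) s \ mix D P ∪ X := by
        intro x
        simp only [mix, Set.mem_symmDiff, Set.mem_union, Set.mem_inter_iff, Set.mem_sdiff]
        tauto
      have := (measureReal_mono this (measure_ne_top lam _)).trans (measureReal_union_le _ _)
      linarith [hsum n]
  · intro m hm
    have hm0 : (0 : ℝ) < m := by exact_mod_cast hn.trans hm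
    obtain ⟨p1, p2⟩ := hphi s m (hn.trans hm)
    set W := symmDiff P.1 P.2 ∩ cyl (n + 1) s with hW
    have mW : MeasurableSet W := (h1.symmDiff h2).inter hU
    have heq : mix (symmDiff D X) P ∩ cyl (n + 1) s ∪ X ∩ (W ∩ mix D P) =
        mix D P ∩ cyl (n + 1) s ∪ X ∩ (W \ mix D P) := by
      ext x
      simp only [hW, mix, Set.mem_symmDiff, Set.mem_union, Set.mem_inter_iff, Set.mem_sdiff]
      by_cases a : x ∈ D <;> by_cases b : x ∈ X <;> by_cases c : x ∈ P.1 <;>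
        by_cases d : x ∈ P.2 <;> simp [a, b, c, d]
    have d1 : Disjoint (mix (symmDiff D X) P ∩ cyl (n + 1) s) (X ∩ (W ∩ mix D P)) := by
      rw [Set.disjoint_left]
      intro x
      simp only [hW, mix, Set.mem_symmDiff, Set.mem_union, Set.mem_inter_iff, Set.mem_sdiff]
      by_cases a : x ∈ D <;> by_cases b : x ∈ X <;> by_cases c : x ∈ P.1 <;>
        by_cases d : x ∈ P.2 <;> simp [a, b, c, d]
    have d2 : Disjoint (mix D P ∩ cyl (n + 1) s) (X ∩ (W \ mix D P)) :=
      Set.disjoint_left.2 fun x hx hx' => hx'.2.2 hx.1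
    have e1 := imb_union m (hX.inter (mW.inter mS)) d1
    have e2 := imb_union m (hX.inter (mW.diff mS)) d2
    rw [heq] at e1
    have e3 := (hT s).2 m hm
    rw [phi_eq_abs_imb] at e3 p1 p2 ⊢
    have h2η : 2 * η / m ≤ (ε' - ε) * (1 / 2) ^ (n + 1) / m := by
      refine div_le_div_of_nonneg_right (hη.trans (div_le_self ?_ hn1)) hm0.le
      have h0 : 0 ≤ (ε' - ε) * (1 / 2) ^ (n + 1) / n := by linarith
      rwa [le_div_iff₀ (by linarith), zero_mul] at h0
    have e4 : imb m (mix (symmDiff D X) P ∩ cyl (n + 1) s) = imb m (mix D P ∩ cyl (n + 1) s)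
        + imb m (X ∩ (W \ mix D P)) - imb m (X ∩ (W ∩ mix D P)) := by linarith
    have e5 : η / m + η / m = 2 * η / m := by ring
    rw [← hsum m, e4, abs_le]
    constructor <;> linarith [(abs_le.1 e3).1, (abs_le.1 e3).2, (abs_le.1 p1).1, (abs_le.1 p1).2,
      (abs_le.1 p2).1, (abs_le.1 p2).2]

/-- A promise kept by `D` survives all modifications of `D` that are sufficiently small and balanced on
finitely many sets. -/
theorem Promise.Holds.exists_stable {ℬ : BooleanSubalgebra (Set Cantor)} (hT : PropertyT ℬ)
    {π : Promise} (hn : 0 < π.n) (hF : ∀ P ∈ π.F, P.1 ∈ ℬ ∧ P.2 ∈ ℬ) {D : Set Cantor} (hD : D ∈ ℬ)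
    (h : π.Holds D) :
    ∃ η > 0, ∃ F : Finset (Set Cantor), (∀ A ∈ F, A ∈ ℬ) ∧ ∀ X ∈ ℬ, lam.real X ≤ η →
      (∀ A ∈ F, ∀ m : ℕ, 0 < m → phi m (X ∩ A) ≤ η / m) → π.Holds (symmDiff D X) := by
  classical
  obtain ⟨⟨ε', hε', hT'⟩, hdist⟩ := h
  have hn0 : (0 : ℝ) < π.n := by exact_mod_cast hn
  set p : ℝ := (1 / 2) ^ (π.n + 1) with hp
  have hp0 : 0 < p := by positivity
  set d := lam.real (symmDiff D π.D₀)
  have hg : 0 < π.ε - ε' := sub_pos.2 hε'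
  have hgd : 0 < π.ε - d := sub_pos.2 hdist
  let W := fun (P : Set Cantor × Set Cantor) (s : Fin (π.n + 1) → Bool) =>
    symmDiff P.1 P.2 ∩ cyl (π.n + 1) s
  have hsymm : ∀ {A B : Set Cantor}, A ∈ ℬ → B ∈ ℬ → symmDiff A B ∈ ℬ := fun hA hB =>
    ℬ.sup_mem (ℬ.sdiff_mem hA hB) (ℬ.sdiff_mem hB hA)
  have hW : ∀ P ∈ π.F, ∀ s, W P s ∈ ℬ := fun P hP s =>
    ℬ.inf_mem (hsymm (hF P hP).1 (hF P hP).2) (hT.clopen _ (isClopen_cyl _ s))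
  have hmix : ∀ P ∈ π.F, mix D P ∈ ℬ := fun P hP => mix_mem hD (hF P hP).1 (hF P hP).2
  let I : Finset ((Set Cantor × Set Cantor) × (Fin (π.n + 1) → Bool)) := π.F ×ˢ Finset.univ
  refine ⟨min ((π.ε - ε') * p / (4 * π.n)) ((π.ε - d) / 2), by positivity,
    I.image (fun i => W i.1 i.2 \ mix D i.1) ∪ I.image (fun i => W i.1 i.2 ∩ mix D i.1), ?_, ?_⟩
  · intro A hA
    rcases Finset.mem_union.1 hA with hA | hA <;>
      obtain ⟨i, hi, rfl⟩ := Finset.mem_image.1 hA <;>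
      have hi := (Finset.mem_product.1 hi).1
    · exact ℬ.sdiff_mem (hW _ hi _) (hmix _ hi)
    · exact ℬ.inf_mem (hW _ hi _) (hmix _ hi)
  · intro X hX hXη hphi
    refine ⟨⟨(π.ε + ε') / 2, by linarith, fun P hP => ?_⟩, ?_⟩
    · refine (hT' P hP).symmDiff_mix hn (hT.borel D hD) (hT.borel X hX) (hT.borel _ (hF P hP).1)
        (hT.borel _ (hF P hP).2) (by positivity) ?_ hXη fun s m hm => ⟨?_, ?_⟩
      · calc _ ≤ 2 * ((π.ε - ε') * p / (4 * π.n)) := by gcongr; exact min_le_left _ _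
          _ = _ := by field_simp; ring
      · exact hphi _ (Finset.mem_union_left _ (Finset.mem_image.2
          ⟨(P, s), Finset.mem_product.2 ⟨hP, Finset.mem_univ s⟩, rfl⟩)) m hm
      · exact hphi _ (Finset.mem_union_right _ (Finset.mem_image.2
          ⟨(P, s), Finset.mem_product.2 ⟨hP, Finset.mem_univ s⟩, rfl⟩)) m hm
    · have h1 := lam_real_symmDiff_triangle (symmDiff D X) D π.D₀
      have h2 : symmDiff (symmDiff D X) D = X := by
        rw [symmDiff_comm D X, symmDiff_assoc, symmDiff_self, symmDiff_bot]
      rw [h2] at h1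
      have := hXη.trans (min_le_right _ _)
      linarith

theorem exists_stable_of_finset {ℬ : BooleanSubalgebra (Set Cantor)} (hT : PropertyT ℬ)
    (𝒮 : Finset Promise) {D : Set Cantor} (hD : D ∈ ℬ)
    (h𝒮 : ∀ π ∈ 𝒮, π.Holds D ∧ 0 < π.n ∧ ∀ P ∈ π.F, P.1 ∈ ℬ ∧ P.2 ∈ ℬ) :
    ∃ η > 0, ∃ F : Finset (Set Cantor), (∀ A ∈ F, A ∈ ℬ) ∧ ∀ X ∈ ℬ, lam.real X ≤ η →
      (∀ A ∈ F, ∀ m : ℕ, 0 < m → phi m (X ∩ A) ≤ η / m) → ∀ π ∈ 𝒮, π.Holds (symmDiff D X) := by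
  classical
  induction 𝒮 using Finset.induction_on with
  | empty => exact ⟨1, one_pos, ∅, by simp, by simp⟩
  | insert π 𝒮 _ ih =>
    obtain ⟨η₁, h1, F₁, hF₁, H₁⟩ := ih fun π hπ => h𝒮 π (Finset.mem_insert_of_mem hπ)
    obtain ⟨hh, hn, hF⟩ := h𝒮 π (Finset.mem_insert_self _ _)
    obtain ⟨η₂, h2, F₂, hF₂, H₂⟩ := hh.exists_stable hT hn hF hD
    refine ⟨min η₁ η₂, lt_min h1 h2, F₁ ∪ F₂, ?_, fun X hX hXη hphi => ?_⟩
    · intro A hA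
      rcases Finset.mem_union.1 hA with hA | hA
      exacts [hF₁ A hA, hF₂ A hA]
    · intro π' hπ'
      rcases Finset.mem_insert.1 hπ' with rfl | hπ'
      · refine H₂ X hX (hXη.trans (min_le_right _ _)) fun A hA m hm => ?_
        refine (hphi A (Finset.mem_union_right _ hA) m hm).trans ?_
        gcongr
        exact min_le_right _ _
      · refine H₁ X hX (hXη.trans (min_le_left _ _)) (fun A hA m hm => ?_) π' hπ'
        refine (hphi A (Finset.mem_union_left _ hA) m hm).trans ?_
        gcongr
        exact min_le_left _ _

/-- A forcing condition: an approximation `D ∈ 𝒞` of the generic set, the finite set `h` of those indices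
`i` for which the trace on `H i` is decided, and finitely many promises kept by `D`. The counter `c`
makes the order antisymmetric. -/
structure Condition (ℬ 𝒞 : BooleanSubalgebra (Set Cantor)) (H : ℕ → Set Cantor) where
  D : Set Cantor
  mem : D ∈ 𝒞
  h : Finset ℕ
  promises : Finset Promise
  c : ℕ
  keeps : ∀ π ∈ promises, π.Holds D ∧ 0 < π.n ∧ ∀ P ∈ π.F, P.1 ∈ ℬ ∧ P.2 ∈ ℬ

namespace Condition

variable {ℬ 𝒞 : BooleanSubalgebra (Set Cantor)} {H : ℕ → Set Cantor}

/-- The condition `q` carries all decisions and promises of `p`. -/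
def Extends (q p : Condition ℬ 𝒞 H) : Prop :=
  p.h ⊆ q.h ∧ p.promises ⊆ q.promises ∧ ∀ i ∈ p.h, q.D ∩ H i = p.D ∩ H i

theorem Extends.refl (p : Condition ℬ 𝒞 H) : p.Extends p :=
  ⟨subset_rfl, subset_rfl, fun _ _ => rfl⟩

theorem Extends.trans {r q p : Condition ℬ 𝒞 H} (h1 : r.Extends q) (h2 : q.Extends p) :
    r.Extends p :=
  ⟨h2.1.trans h1.1, h2.2.1.trans h1.2.1, fun i hi => (h1.2.2 i (h2.1 hi)).trans (h2.2.2 i hi)⟩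

instance : PartialOrder (Condition ℬ 𝒞 H) where
  le q p := q = p ∨ (p.c < q.c ∧ q.Extends p)
  le_refl p := Or.inl rfl
  le_trans r q p h1 h2 := by
    rcases h1 with rfl | h1
    · exact h2
    · rcases h2 with rfl | h2
      · exact Or.inr h1
      · exact Or.inr ⟨h2.1.trans h1.1, h1.2.trans h2.2⟩
  le_antisymm q p h1 h2 := by
    rcases h1 with h1 | h1
    · exact h1
    · rcases h2 with h2 | h2
      · exact h2.symm
      · exact absurd h1.1 h2.1.not_gt

theorem le_of_extends {q p : Condition ℬ 𝒞 H} (hc : p.c < q.c) (h : q.Extends p) : q ≤ p :=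
  Or.inr ⟨hc, h⟩

theorem extends_of_le {q p : Condition ℬ 𝒞 H} (h : q ≤ p) : q.Extends p := by
  rcases h with rfl | h
  exacts [Extends.refl _, h.2]

instance : Nonempty (Condition ℬ 𝒞 H) :=
  ⟨⟨∅, 𝒞.bot_mem, ∅, ∅, 0, by simp⟩⟩

/-- Conditions with the same approximation and the same decided indices are compatible: their promises
can be put together. -/
theorem isSigmaCentered (hcount : (𝒞 : Set (Set Cantor)).Countable) :
    IsSigmaCentered (Condition ℬ 𝒞 H) := by
  classical
  have : Countable 𝒞 := hcount.to_subtype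
  obtain ⟨e, he⟩ := exists_surjective_nat (𝒞 × Finset ℕ)
  refine ⟨fun i => {p | (⟨p.D, p.mem⟩, p.h) = e i}, ?_, fun i F hne hF => ?_⟩
  · refine Set.eq_univ_of_forall fun p => ?_
    obtain ⟨i, hi⟩ := he (⟨p.D, p.mem⟩, p.h)
    exact Set.mem_iUnion.2 ⟨i, hi.symm⟩
  · have hD : ∀ p ∈ F, p.D = (e i).1 := fun p hp => congrArg (fun z => (z.1 : Set Cantor)) (hF hp)
    have hh : ∀ p ∈ F, p.h = (e i).2 := fun p hp => congrArg Prod.snd (hF hp)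
    refine ⟨⟨(e i).1, (e i).1.2, (e i).2, F.biUnion fun p => p.promises, F.sup (fun p => p.c) + 1, ?_⟩,
      fun p hp => le_of_extends ?_ ⟨(hh p hp).subset, ?_, fun j _ => ?_⟩⟩
    · intro π hπ
      obtain ⟨p, hp, hπ⟩ := Finset.mem_biUnion.1 hπ
      rw [← hD p hp]
      exact p.keeps π hπ
    · exact Nat.lt_succ_of_le (Finset.le_sup (f := fun p => p.c) hp)
    · exact Finset.subset_biUnion_of_mem (fun p => p.promises) hp
    · simp only [hD p hp]

/-- Promises can be added for any finite family; property (T) of `ℬ` supplies their levels. -/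
theorem exists_le_promise (hT : PropertyT ℬ) (hle : 𝒞 ≤ ℬ) (p : Condition ℬ 𝒞 H)
    (F : Finset (Set Cantor × Set Cantor)) (hF : ∀ P ∈ F, P.1 ∈ ℬ ∧ P.2 ∈ ℬ) {ε : ℝ} (hε : 0 < ε) :
    ∃ q ≤ p, ∃ π ∈ q.promises, π.F = F ∧ π.ε = ε := by
  classical
  obtain ⟨n, hn, -, h⟩ := hT.exists_level (F.image (mix p.D)) (by
    intro A hA
    obtain ⟨P, hP, rfl⟩ := Finset.mem_image.1 hA
    exact mix_mem (hle p.mem) (hF P hP).1 (hF P hP).2) (half_pos hε) 0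
  refine ⟨⟨p.D, p.mem, p.h, insert ⟨n, ε, F, p.D⟩ p.promises, p.c + 1, ?_⟩, le_of_extends (Nat.lt_succ_self _)
    ⟨subset_rfl, Finset.subset_insert _ _, fun _ _ => rfl⟩, _, Finset.mem_insert_self _ _, rfl, rfl⟩
  intro π hπ
  rcases Finset.mem_insert.1 hπ with rfl | hπ
  · refine ⟨⟨⟨ε / 2, half_lt_self hε, fun P hP => h _ (Finset.mem_image_of_mem _ hP)⟩, ?_⟩, hn, hF⟩
    simpa using hε
  · exact p.keeps π hπ

/-- Arbitrarily late traces can be decided in an arbitrary way. -/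
theorem exists_le_decided (hT : PropertyT ℬ) (hle : 𝒞 ≤ ℬ)
    (hclopen : ∀ A : Set Cantor, IsClopen A → A ∈ 𝒞) (hH : ∀ i, H i ∈ 𝒞)
    (hanti : ∀ i j, i ≠ j → Disjoint (H i) (H j)) {E : ℕ → Set Cantor} (hE : ∀ i, E i ∈ 𝒞)
    (hEH : ∀ i, E i ⊆ H i) (p : Condition ℬ 𝒞 H) (j : ℕ) :
    ∃ q ≤ p, ∃ i ≥ j, i ∈ q.h ∧ q.D ∩ H i = E i := by
  classical
  obtain ⟨η, hη, F, hF, hstable⟩ := exists_stable_of_finset hT p.promises (hle p.mem) p.keeps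
  have hsymm : ∀ {A B : Set Cantor}, A ∈ 𝒞 → B ∈ 𝒞 → symmDiff A B ∈ 𝒞 := fun hA hB =>
    𝒞.sup_mem (𝒞.sdiff_mem hA hB) (𝒞.sdiff_mem hB hA)
  let K := ⋃ i ∈ p.h, H i
  have hK : K ∈ 𝒞 := BooleanSubalgebra.biSup_mem p.h.finite_toSet fun i _ => hH i
  obtain ⟨α, hα, hmod⟩ := exists_balanced_modification hT hle hclopen F hF hK hη
  have hlim : Filter.Tendsto (fun i => lam.real (H i)) Filter.atTop (nhds 0) := by
    have h1 : ∑' i, lam (H i) ≠ ⊤ := by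
      rw [← measure_iUnion hanti fun i => hT.borel _ (hle (hH i))]
      exact measure_ne_top _ _
    have h2 := ENNReal.tendsto_atTop_zero_of_tsum_ne_top h1
    have h3 := (ENNReal.tendsto_toReal ENNReal.zero_ne_top).comp h2
    rwa [ENNReal.toReal_zero] at h3
  obtain ⟨i, hi, hij, hip⟩ := ((hlim.eventually_le_const hα).and
    ((Filter.eventually_ge_atTop j).and
      (Filter.eventually_gt_atTop (p.h.sup id)))).exists
  have hip' : ∀ k ∈ p.h, k ≠ i := fun k hk hki => by
    have := Finset.le_sup (f := id) hk
    simp only [id] at this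
    omega
  have hHK : Disjoint (H i) K := by
    rw [Set.disjoint_iUnion₂_right]
    exact fun k hk => hanti i k (hip' k hk).symm
  obtain ⟨X, hX, hXH, hXK, hXη, hphi⟩ := hmod (H i) (hH i) (symmDiff (E i) (p.D ∩ H i))
    (hsymm (hE i) (𝒞.inf_mem p.mem (hH i)))
    (by
      rintro x (hx | hx)
      exacts [hEH i hx.1, hx.1.2]) hHK hi
  refine ⟨⟨symmDiff p.D X, hsymm p.mem hX, insert i p.h, p.promises, p.c + 1, fun π hπ =>
      ⟨hstable X (hle hX) hXη hphi π hπ, (p.keeps π hπ).2⟩⟩,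
    le_of_extends (Nat.lt_succ_self _) ⟨Finset.subset_insert _ _, subset_rfl, fun k hk => ?_⟩,
    i, hij, Finset.mem_insert_self _ _, ?_⟩
  · have h0 : X ∩ H k = ∅ := by
      rw [← Set.disjoint_iff_inter_eq_empty]
      exact hXK.mono_right (Set.subset_biUnion_of_mem (u := fun i => H i) hk)
    change symmDiff p.D X ∩ H k = p.D ∩ H k
    rw [Set.inter_symmDiff_distrib_right, h0]
    exact symmDiff_bot _
  · change symmDiff p.D X ∩ H i = E i
    rw [Set.inter_symmDiff_distrib_right, hXH, symmDiff_comm (E i), ← symmDiff_assoc, symmDiff_self,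
      bot_symmDiff]

end Condition

/-! ### The generic set -/

/-- A sequence of sets with `λ(D_j ∆ D_k) ≤ 2 · 2⁻ᵏ` for `k ≤ j` converges in measure to its upper
limit. -/
theorem lam_real_symmDiff_limsup_le {D : ℕ → Set Cantor}
    (hD : ∀ k, lam.real (symmDiff (D k) (D (k + 1))) ≤ 2 * (1 / 2) ^ k) (k : ℕ) :
    lam.real (symmDiff (⋂ i, ⋃ j ≥ i, D j) (D k)) ≤ 4 * (1 / 2) ^ k := by
  have hsub : symmDiff (⋂ i, ⋃ j ≥ i, D j) (D k) ⊆ ⋃ j, symmDiff (D (k + j)) (D (k + j + 1)) := by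
    intro x hx
    by_contra hcon
    simp only [Set.mem_iUnion, not_exists] at hcon
    have hconst : ∀ j, x ∈ D (k + j) ↔ x ∈ D k := by
      intro j
      induction j with
      | zero => rfl
      | succ j ih =>
        have := hcon j
        simp only [Set.mem_symmDiff] at this
        rw [← ih, ← add_assoc]
        tauto
    rcases hx with ⟨h1, h2⟩ | ⟨h1, h2⟩
    · obtain ⟨j, hj, hxj⟩ := Set.mem_iUnion₂.1 (Set.mem_iInter.1 h1 k)
      obtain ⟨j, rfl⟩ := Nat.exists_eq_add_of_le hj
      exact h2 ((hconst j).1 hxj)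
    · refine h2 (Set.mem_iInter.2 fun i => Set.mem_iUnion₂.2 ⟨k + i, by omega, (hconst i).2 h1⟩)
  have hg : HasSum (fun j : ℕ => 2 * (1 / 2 : ℝ) ^ (k + j)) (4 * (1 / 2) ^ k) := by
    have h1 := (hasSum_geometric_two).mul_left (2 * (1 / 2 : ℝ) ^ k)
    have h2 : (fun j : ℕ => 2 * (1 / 2 : ℝ) ^ (k + j)) =
        fun j => 2 * (1 / 2 : ℝ) ^ k * (1 / 2) ^ j := funext fun j => by rw [pow_add, mul_assoc]
    have h3 : (4 : ℝ) * (1 / 2) ^ k = 2 * (1 / 2) ^ k * 2 := by ring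
    rwa [h2, h3]
  have hE : lam (symmDiff (⋂ i, ⋃ j ≥ i, D j) (D k)) ≤ ENNReal.ofReal (4 * (1 / 2) ^ k) := by
    calc _ ≤ lam (⋃ j, symmDiff (D (k + j)) (D (k + j + 1))) := measure_mono hsub
      _ ≤ ∑' j, lam (symmDiff (D (k + j)) (D (k + j + 1))) := measure_iUnion_le _
      _ ≤ ∑' j : ℕ, ENNReal.ofReal (2 * (1 / 2 : ℝ) ^ (k + j)) := by
          refine ENNReal.tsum_le_tsum fun j => ?_
          rw [← ofReal_measureReal (measure_ne_top _ _)]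
          exact ENNReal.ofReal_le_ofReal (hD (k + j))
      _ = ENNReal.ofReal (4 * (1 / 2) ^ k) := by
          rw [← ENNReal.ofReal_tsum_of_nonneg (fun j => by positivity) hg.summable, hg.tsum_eq]
  exact ENNReal.toReal_le_of_le_ofReal (by positivity) hE

namespace Condition

variable {ℬ 𝒞 : BooleanSubalgebra (Set Cantor)} {H : ℕ → Set Cantor}

/-- The generic set: the approximations in a sufficiently generic filter converge in measure to a Borel
set that has the decided traces and keeps, in the limit, all promises. -/
theorem exists_generic (hT : PropertyT ℬ) (hle : 𝒞 ≤ ℬ) (G : Order.PFilter (Condition ℬ 𝒞 H))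
    (hG : ∀ k : ℕ, ∃ p ∈ G, ∃ π ∈ p.promises, π.ε = (1 / 2) ^ k) :
    ∃ B, MeasurableSet B ∧ (∀ p ∈ G, ∀ i ∈ p.h, B ∩ H i = p.D ∩ H i) ∧
      ∀ p ∈ G, ∀ π ∈ p.promises, ∀ P ∈ π.F, IsTame π.n π.ε (mix B P) := by
  classical
  have mD : ∀ p : Condition ℬ 𝒞 H, MeasurableSet p.D := fun p => hT.borel _ (hle p.mem)
  have hdir : ∀ p q : G, ∃ r : G, (r : Condition ℬ 𝒞 H) ≤ p ∧ (r : Condition ℬ 𝒞 H) ≤ q := by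
    intro p q
    obtain ⟨r, hr, h1, h2⟩ := G.directed p p.2 q q.2
    exact ⟨⟨r, hr⟩, h1, h2⟩
  choose g hg1 hg2 using hdir
  choose a haG π haπ hπε using hG
  -- `b i` decides the trace on `H i`, if some element of `G` does
  have hb : ∀ i, ∃ b : G, (∃ p ∈ G, i ∈ p.h) → i ∈ b.1.h := by
    intro i
    by_cases h : ∃ p ∈ G, i ∈ p.h
    · obtain ⟨p, hp, hi⟩ := h
      exact ⟨⟨p, hp⟩, fun _ => hi⟩
    · exact ⟨⟨a 0, haG 0⟩, fun h' => absurd h' h⟩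
  choose b hb using hb
  let z : ℕ → G := fun k => g ⟨a k, haG k⟩ (b k)
  let q : ℕ → G := fun k => Nat.rec (z 0) (fun k r => g r (z (k + 1))) k
  have hqz : ∀ k, (q k).1 ≤ (z k).1 := by
    intro k
    cases k with
    | zero => exact le_rfl
    | succ k => exact hg2 _ _
  have hqanti : Antitone fun k => (q k).1 :=
    antitone_nat_of_succ_le fun k => hg1 (q k) _
  have hclose : ∀ k, ∀ r : Condition ℬ 𝒞 H, r ≤ (q k).1 →
      lam.real (symmDiff r.D (π k).D₀) ≤ (1 / 2) ^ k := by
    intro k r hr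
    have hra : r ≤ a k := hr.trans ((hqz k).trans (hg1 _ _))
    have := (r.keeps (π k) ((extends_of_le hra).2.1 (haπ k))).1.2
    rw [hπε] at this
    exact this.le
  have hclose2 : ∀ k, ∀ r r' : Condition ℬ 𝒞 H, r ≤ (q k).1 → r' ≤ (q k).1 →
      lam.real (symmDiff r.D r'.D) ≤ 2 * (1 / 2) ^ k := by
    intro k r r' h h'
    have h1 := lam_real_symmDiff_triangle r.D (π k).D₀ r'.D
    rw [symmDiff_comm (π k).D₀] at h1
    linarith [hclose k r h, hclose k r' h']
  set B : Set Cantor := ⋂ i, ⋃ j ≥ i, (q j).1.D with hBdef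
  have hBlim : ∀ k, lam.real (symmDiff B (q k).1.D) ≤ 4 * (1 / 2) ^ k :=
    lam_real_symmDiff_limsup_le fun k => hclose2 k _ _ le_rfl (hqanti (Nat.le_succ k))
  have hB : MeasurableSet B := MeasurableSet.iInter fun i => MeasurableSet.iUnion fun j =>
    MeasurableSet.iUnion fun _ => mD _
  refine ⟨B, hB, fun p hp i hi => ?_, fun p hp ρ hρ P hP => ?_⟩
  · have hqi : ∀ j ≥ i, (q j).1.D ∩ H i = p.D ∩ H i := by
      intro j hj
      have h1 : (q j).1 ≤ (b i).1 := (hqanti hj).trans ((hqz i).trans (hg2 _ _))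
      have h2 : i ∈ (b i).1.h := hb i ⟨p, hp, hi⟩
      have h3 := (extends_of_le h1).2.2 i h2
      have h4 := (extends_of_le (hg1 ⟨p, hp⟩ (b i))).2.2 i hi
      have h5 := (extends_of_le (hg2 ⟨p, hp⟩ (b i))).2.2 i h2
      rw [h3, ← h5, h4]
    ext x
    have hx : ∀ j ≥ i, (x ∈ (q j).1.D ∧ x ∈ H i) ↔ (x ∈ p.D ∧ x ∈ H i) := fun j hj =>
      Set.ext_iff.1 (hqi j hj) x
    simp only [hBdef, Set.mem_inter_iff, Set.mem_iInter, Set.mem_iUnion, exists_prop]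
    constructor
    · rintro ⟨h, hxH⟩
      obtain ⟨j, hj, hxj⟩ := h i
      exact (hx j hj).1 ⟨hxj, hxH⟩
    · rintro ⟨hxD, hxH⟩
      exact ⟨fun k => ⟨max i k, le_max_right _ _, ((hx _ (le_max_left _ _)).2 ⟨hxD, hxH⟩).1⟩, hxH⟩
  · obtain ⟨-, -, hF⟩ := p.keeps ρ hρ
    have m1 := hT.borel _ (hF P hP).1
    have m2 := hT.borel _ (hF P hP).2
    refine isTame_of_forall_exists (measurableSet_mix hB m1 m2) fun δ hδ => ?_
    obtain ⟨k, hk⟩ := exists_pow_lt_of_lt_one (show 0 < δ / 6 by linarith)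
      (show (1 / 2 : ℝ) < 1 by norm_num)
    let r := g ⟨p, hp⟩ (q k)
    have hr1 := extends_of_le (hg1 ⟨p, hp⟩ (q k))
    have hr2 : r.1 ≤ (q k).1 := hg2 ⟨p, hp⟩ (q k)
    refine ⟨mix r.1.D P, measurableSet_mix (mD _) m1 m2, ?_, ?_⟩
    · have h1 := measureReal_mono (symmDiff_mix_subset B r.1.D P) (measure_ne_top lam _)
      have h2 := lam_real_symmDiff_triangle B (q k).1.D r.1.D
      linarith [hBlim k, hclose2 k _ _ le_rfl hr2]
    · obtain ⟨ε', hε', h⟩ := (r.1.keeps ρ (hr1.2.1 hρ)).1.1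
      exact (h P hP).mono hε'.le

end Condition

/-- Every member of the algebra generated by `ℬ` and `B` is of the form `(A₁ ∩ B) ∪ (A₂ \ B)`. -/
theorem exists_mix_of_mem_closure {ℬ : BooleanSubalgebra (Set Cantor)} {B A : Set Cantor}
    (hA : A ∈ BooleanSubalgebra.closure ((ℬ : Set (Set Cantor)) ∪ {B})) :
    ∃ P : ℬ × ℬ, A = mix B (P.1, P.2) := by
  induction hA using BooleanSubalgebra.closure_bot_sup_induction with
  | mem A hA =>
    rcases hA with hA | hA
    · exact ⟨(⟨A, hA⟩, ⟨A, hA⟩), (Set.inter_union_sdiff A B).symm⟩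
    · obtain rfl : A = B := hA
      exact ⟨(⊤, ⊥), by simp [mix]⟩
  | bot => exact ⟨(⊥, ⊥), by simp [mix]⟩
  | sup A _ A' _ hA hA' =>
    obtain ⟨P, rfl⟩ := hA
    obtain ⟨P', rfl⟩ := hA'
    refine ⟨(P.1 ⊔ P'.1, P.2 ⊔ P'.2), ?_⟩
    ext x
    simp only [mix, Set.sup_eq_union, BooleanSubalgebra.val_sup, Set.mem_union, Set.mem_inter_iff,
      Set.mem_sdiff]
    tauto
  | compl A _ hA =>
    obtain ⟨P, rfl⟩ := hA
    refine ⟨(P.1ᶜ, P.2ᶜ), ?_⟩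
    ext x
    simp only [mix, BooleanSubalgebra.val_compl, Set.mem_union, Set.mem_inter_iff,
      Set.mem_sdiff, Set.mem_compl_iff]
    tauto

/-- A set of variation greater than `2c` contains a set whose measure exceeds `c` in absolute value,
namely the positive or the negative part of a partition. -/
theorem BA.exists_le_abs_of_lt_variation {α : Type*} [BooleanAlgebra α] (μ : BA α) {a : α} {c : ℝ}
    (h : 2 * c < μ.variation a) : ∃ b ≤ a, c ≤ |μ b| := by
  classical
  obtain ⟨P, hP⟩ := exists_lt_of_lt_ciSup h
  have hd : ∀ (p : α → Prop) [DecidablePred p],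
      ((P.parts.filter p : Finset α) : Set α).PairwiseDisjoint id :=
    fun p _ => P.disjoint.subset fun x hx => (Finset.mem_filter.1 hx).1
  have hle : ∀ (p : α → Prop) [DecidablePred p], (P.parts.filter p).sup id ≤ a := fun p _ =>
    Finset.sup_le fun b hb => P.le (Finset.mem_filter.1 hb).1
  have h1 := μ.map_finset_sup _ (hd fun b => 0 ≤ μ b)
  have h2 := μ.map_finset_sup _ (hd fun b => ¬ 0 ≤ μ b)
  have e1 : ∑ b ∈ P.parts.filter (fun b => 0 ≤ μ b), |μ b|
      = ∑ b ∈ P.parts.filter (fun b => 0 ≤ μ b), μ b :=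
    Finset.sum_congr rfl fun b hb => abs_of_nonneg (Finset.mem_filter.1 hb).2
  have e2 : ∑ b ∈ P.parts.filter (fun b => ¬ 0 ≤ μ b), |μ b|
      = - ∑ b ∈ P.parts.filter (fun b => ¬ 0 ≤ μ b), μ b := by
    rw [← Finset.sum_neg_distrib]
    exact Finset.sum_congr rfl fun b hb => abs_of_neg (not_le.1 (Finset.mem_filter.1 hb).2)
  rw [← Finset.sum_filter_add_sum_filter_not P.parts (fun b => 0 ≤ μ b), e1, e2, ← h1, ← h2] at hP
  by_contra! hcon
  have c1 := hcon _ (hle fun b => 0 ≤ μ b)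
  have c2 := hcon _ (hle fun b => ¬ 0 ≤ μ b)
  linarith [le_abs_self (μ ((P.parts.filter fun b => 0 ≤ μ b).sup id)),
    neg_le_abs (μ ((P.parts.filter fun b => ¬ 0 ≤ μ b).sup id))]

theorem mk_finset_prod_lt_continuum {α : Type} (h : #α < 𝔠) : #(Finset (α × α) × ℕ) < 𝔠 := by
  have h2 : #(Finset (α × α)) < 𝔠 := by
    rcases finite_or_infinite (α × α) with hfin | hinf
    · exact (Cardinal.mk_le_aleph0 (α := Finset (α × α))).trans_lt Cardinal.aleph0_lt_continuum
    · rw [Cardinal.mk_finset_of_infinite, Cardinal.mk_prod, Cardinal.lift_id]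
      exact Cardinal.mul_lt_of_lt Cardinal.aleph0_le_continuum h h
  rw [Cardinal.mk_prod, Cardinal.lift_id, Cardinal.lift_id]
  exact Cardinal.mul_lt_of_lt Cardinal.aleph0_le_continuum h2
    (by simpa using Cardinal.aleph0_lt_continuum)

end CantorT

theorem lemma3p6
    (hMA : CantorT.MASigmaCentered)
    (ℬ 𝒞 : BooleanSubalgebra (Set CantorT.Cantor))
    (hT : CantorT.PropertyT ℬ)
    (hcard : #ℬ < 𝔠)
    (hle : 𝒞 ≤ ℬ)
    (hcount : (𝒞 : Set (Set CantorT.Cantor)).Countable)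
    (hclopen : ∀ A : Set CantorT.Cantor, IsClopen A → A ∈ 𝒞)
    (ν : ℕ → CantorT.BA 𝒞)
    (H : ℕ → 𝒞)
    (hanti : ∀ i j : ℕ, i ≠ j → Disjoint (H i) (H j))
    (hnorm : ∀ n : ℕ, (ν n).totalVariation = 1)
    (hH : ∀ n : ℕ, 0.95 ≤ (ν n).variation (H n))
    (θ : CantorT.BA 𝒞)
    (hθ_nonneg : ∀ A : 𝒞, 0 ≤ θ A)
    (hθ : ∀ A : 𝒞, Filter.Tendsto (fun n : ℕ => (ν n).variation A) Filter.atTop (nhds (θ A))) :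
    ∃ (B : Set CantorT.Cantor) (n : ℕ → ℕ),
      MeasurableSet B ∧
      StrictMono n ∧
      CantorT.PropertyT
        (BooleanSubalgebra.closure ((ℬ : Set (Set CantorT.Cantor)) ∪ {B})) ∧
      ∃ hB : ∀ k : ℕ, B ∩ (H (n k) : Set CantorT.Cantor) ∈ 𝒞,
        ∀ k : ℕ,
          |ν (n (2 * k)) ⟨B ∩ (H (n (2 * k)) : Set CantorT.Cantor), hB (2 * k)⟩| ≤ 0.1 ∧
          0.3 ≤ |ν (n (2 * k + 1))
            ⟨B ∩ (H (n (2 * k + 1)) : Set CantorT.Cantor), hB (2 * k + 1)⟩| := by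
  classical
  have hanti' : ∀ i j, i ≠ j → Disjoint (H i : Set CantorT.Cantor) (H j) := fun i j hij => by
    rw [Set.disjoint_iff_inter_eq_empty]
    exact congrArg Subtype.val (hanti i j hij).eq_bot
  choose E hEH hE using fun i => (ν i).exists_le_abs_of_lt_variation (a := H i) (c := 0.3)
    (lt_of_lt_of_le (by norm_num) (hH i))
  let ℙ := CantorT.Condition ℬ 𝒞 (fun i => (H i : Set CantorT.Cantor))
  let toPairs : Finset (ℬ × ℬ) → Finset (Set CantorT.Cantor × Set CantorT.Cantor) :=
    fun F => F.image fun P => (P.1.1, P.2.1)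
  have htoPairs : ∀ F, ∀ P ∈ toPairs F, P.1 ∈ ℬ ∧ P.2 ∈ ℬ := by
    intro F P hP
    obtain ⟨Q, _, rfl⟩ := Finset.mem_image.1 hP
    exact ⟨Q.1.2, Q.2.2⟩
  -- the dense sets that force property (T), small traces and large traces, respectively
  let 𝒟₁ : Finset (ℬ × ℬ) × ℕ → Set ℙ := fun x =>
    {p | ∃ π ∈ p.promises, π.F = toPairs x.1 ∧ π.ε = (1 / 2) ^ x.2}
  let 𝒟₂ : ℕ → Set ℙ := fun j => {p | ∃ i ≥ j, i ∈ p.h ∧ p.D ∩ H i = ∅}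
  let 𝒟₃ : ℕ → Set ℙ := fun j => {p | ∃ i ≥ j, i ∈ p.h ∧ p.D ∩ H i = E i}
  have hcard𝒟 : #(Set.range 𝒟₁ ∪ (Set.range 𝒟₂ ∪ Set.range 𝒟₃) : Set (Set ℙ)) < 𝔠 := by
    have hℕ : ∀ 𝒟 : ℕ → Set ℙ, #(Set.range 𝒟) < 𝔠 := fun 𝒟 =>
      (Cardinal.mk_le_aleph0_iff.2 (Set.countable_range 𝒟).to_subtype).trans_lt
        Cardinal.aleph0_lt_continuum
    refine (Cardinal.mk_union_le _ _).trans_lt (Cardinal.add_lt_of_lt Cardinal.aleph0_le_continuum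
      (Cardinal.mk_range_le.trans_lt (CantorT.mk_finset_prod_lt_continuum hcard)) ?_)
    exact (Cardinal.mk_union_le _ _).trans_lt (Cardinal.add_lt_of_lt Cardinal.aleph0_le_continuum
      (hℕ _) (hℕ _))
  obtain ⟨G, hG⟩ := hMA ℙ (CantorT.Condition.isSigmaCentered hcount) _ hcard𝒟 (by
    rintro D (⟨x, rfl⟩ | ⟨j, rfl⟩ | ⟨j, rfl⟩) p
    · obtain ⟨q, hq, h⟩ := CantorT.Condition.exists_le_promise hT hle p (toPairs x.1)
        (htoPairs x.1) (show (0 : ℝ) < (1 / 2) ^ x.2 by positivity)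
      exact ⟨q, h, hq⟩
    · obtain ⟨q, hq, h⟩ := CantorT.Condition.exists_le_decided hT hle hclopen (fun i => (H i).2)
        hanti' (E := fun _ => ∅) (fun i => 𝒞.bot_mem) (fun i => Set.empty_subset _) p j
      exact ⟨q, h, hq⟩
    · obtain ⟨q, hq, h⟩ := CantorT.Condition.exists_le_decided hT hle hclopen (fun i => (H i).2)
        hanti' (E := fun i => (E i).1) (fun i => (E i).2) (fun i => hEH i) p j
      exact ⟨q, h, hq⟩)
  have hG₁ : ∀ F k, ∃ p ∈ G, ∃ π ∈ p.promises, π.F = toPairs F ∧ π.ε = (1 / 2) ^ k := by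
    intro F k
    obtain ⟨p, hp, hpG⟩ := hG (𝒟₁ (F, k)) (Or.inl ⟨_, rfl⟩)
    exact ⟨p, hpG, hp⟩
  obtain ⟨B, hBm, hBH, hBT⟩ := CantorT.Condition.exists_generic hT hle G (fun k => by
    obtain ⟨p, hp, π, hπ, -, hε⟩ := hG₁ ∅ k
    exact ⟨p, hp, π, hπ, hε⟩)
  have hfreq : ∀ k : ℕ, ∃ᶠ i in Filter.atTop, ∃ h : B ∩ (H i : Set CantorT.Cantor) ∈ 𝒞,
      (Even k → |ν i ⟨_, h⟩| ≤ 0.1) ∧ (¬ Even k → 0.3 ≤ |ν i ⟨_, h⟩|) := by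
    intro k
    refine Filter.frequently_atTop.2 fun j => ?_
    by_cases hk : Even k
    · obtain ⟨p, ⟨i, hij, hi, hpi⟩, hpG⟩ := hG (𝒟₂ j) (Or.inr (Or.inl ⟨j, rfl⟩))
      have h0 : B ∩ (H i : Set CantorT.Cantor) = ∅ := (hBH p hpG i hi).trans hpi
      have hmem : B ∩ (H i : Set CantorT.Cantor) ∈ 𝒞 := h0 ▸ 𝒞.bot_mem
      refine ⟨i, hij, hmem, fun _ => ?_, fun h => absurd hk h⟩
      have h1 : (⟨B ∩ (H i : Set CantorT.Cantor), hmem⟩ : 𝒞) = ⊥ := Subtype.ext h0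
      rw [h1, (ν i).map_bot]
      norm_num
    · obtain ⟨p, ⟨i, hij, hi, hpi⟩, hpG⟩ := hG (𝒟₃ j) (Or.inr (Or.inr ⟨j, rfl⟩))
      have h0 : B ∩ (H i : Set CantorT.Cantor) = E i := (hBH p hpG i hi).trans hpi
      have hmem : B ∩ (H i : Set CantorT.Cantor) ∈ 𝒞 := h0 ▸ (E i).2
      refine ⟨i, hij, hmem, fun h => absurd h hk, fun _ => ?_⟩
      have h1 : (⟨B ∩ (H i : Set CantorT.Cantor), hmem⟩ : 𝒞) = E i := Subtype.ext h0
      rw [h1]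
      exact hE i
  obtain ⟨n, hn, hnB⟩ := Filter.extraction_forall_of_frequently hfreq
  have hBcl : B ∈ BooleanSubalgebra.closure ((ℬ : Set (Set CantorT.Cantor)) ∪ {B}) :=
    BooleanSubalgebra.subset_closure (Or.inr rfl)
  refine ⟨B, n, hBm, hn, ⟨fun A hA => ?_, fun A hA => ?_, fun F hF ε hε => ?_⟩,
    fun k => (hnB k).1, fun k => ⟨?_, ?_⟩⟩
  · obtain ⟨P, rfl⟩ := CantorT.exists_mix_of_mem_closure hA
    exact CantorT.measurableSet_mix hBm (hT.borel _ P.1.2) (hT.borel _ P.2.2)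
  · exact BooleanSubalgebra.subset_closure (Or.inl (hT.clopen A hA))
  · have hex : ∀ A : Set CantorT.Cantor, ∃ P : ℬ × ℬ, A ∈ F → A = CantorT.mix B (P.1, P.2) := by
      intro A
      by_cases hA : A ∈ F
      · obtain ⟨P, hP⟩ := CantorT.exists_mix_of_mem_closure (hF A hA)
        exact ⟨P, fun _ => hP⟩
      · exact ⟨(⊥, ⊥), fun h => absurd h hA⟩
    choose P hP using hex
    obtain ⟨k, hk⟩ := exists_pow_lt_of_lt_one hε (show (1 / 2 : ℝ) < 1 by norm_num)
    obtain ⟨p, hpG, π, hπ, hπF, hπε⟩ := hG₁ (F.image P) k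
    refine ⟨π.n, (p.keeps π hπ).2.1, CantorT.forall_isAtom_iff.2 fun A hA => ?_⟩
    rw [hP A hA]
    refine (hBT p hpG π hπ _ ?_).mono (hπε ▸ hk.le)
    rw [hπF]
    exact Finset.mem_image_of_mem (fun P : ℬ × ℬ => (P.1.1, P.2.1)) (Finset.mem_image_of_mem P hA)
  · exact (hnB (2 * k)).2.1 (even_two_mul k)
  · exact (hnB (2 * k + 1)).2.2 (by simp)
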